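/- Let $\widehat{\mathbb{C}}=\mathbb{C}\cup\{\infty\}$ be the Riemann sphere and let $f:\widehat{\mathbb{C}}\to\widehat{\mathbb{C}}$ be a rational map. The Fatou set of $f$ is the largest open subset of $\widehat{\mathbb{C}}$ on which the family of iterates $(f^{\circ n})_{n\in\mathbb{N}}$ is normal, that is, on which every sequence of members of the family has a subsequence converging uniformly, for the spherical metric in the range, on compact subsets; the Julia set $\mathcal{J}_f$ is the complement of the Fatou set. A point $z\in\widehat{\mathbb{C}}$ is periodic if $f^{\circ p}(z)=z$ for some integer $p\ge 1$. Then the closure of the set of periodic points of $f$ contains the Julia set: \[ \mathcal{J}_f\subseteq\overline{\{z\in\widehat{\mathbb{C}} : f^{\circ p}(z)=z\text{ for some } p\ge 1\}}. \] -/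

import Mathlib

/-- The Riemann sphere `ℂ ∪ {∞}`, with the topology of the one-point compactification. -/
abbrev RiemannSphere : Type := OnePoint ℂ

namespace RiemannSphere

open Polynomial

/-- The chordal distance on the Riemann sphere: the Euclidean distance in `ℝ³` between the images
of two points under (inverse) stereographic projection to the unit sphere. -/
noncomputable def chordalDist : RiemannSphere → RiemannSphere → ℝ
  | OnePoint.some z, OnePoint.some w => 2 * ‖z - w‖ / (√(1 + ‖z‖ ^ 2) * √(1 + ‖w‖ ^ 2))
  | OnePoint.some z, OnePoint.infty => 2 / √(1 + ‖z‖ ^ 2)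
  | OnePoint.infty, OnePoint.some w => 2 / √(1 + ‖w‖ ^ 2)
  | OnePoint.infty, OnePoint.infty => 0

/-- The spherical distance on the Riemann sphere: the length of the shortest great-circle arc on
the unit sphere between two points, expressed through the chord that it subtends. -/
noncomputable def sphericalDist (p q : RiemannSphere) : ℝ :=
  2 * Real.arcsin (chordalDist p q / 2)

/-- The self-map of the Riemann sphere given by a rational function `R = P / Q`, with `P` and `Q`
coprime and `Q` monic: `z ↦ P(z) / Q(z)`, with value `∞` at the poles; its value at `∞` is the
limit of `P(z) / Q(z)` as `z → ∞`. Constants are allowed. -/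
noncomputable def rationalMap (R : RatFunc ℂ) : RiemannSphere → RiemannSphere
  | OnePoint.some z =>
      open Classical in
      if R.denom.eval z = 0 then OnePoint.infty
      else OnePoint.some (R.num.eval z / R.denom.eval z)
  | OnePoint.infty =>
      if R.denom.natDegree < R.num.natDegree then OnePoint.infty
      else OnePoint.some (R.num.coeff R.denom.natDegree / R.denom.leadingCoeff)

/-- A family of maps is normal on `U` if every sequence of members of the family has a
subsequence that converges, uniformly for the spherical distance in the range, on every compact
subset of `U`. -/
def IsNormalOn {ι : Type*} (F : ι → RiemannSphere → RiemannSphere) (U : Set RiemannSphere) :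
    Prop :=
  ∀ s : ℕ → ι, ∃ φ : ℕ → ℕ, StrictMono φ ∧ ∃ g : RiemannSphere → RiemannSphere,
    ∀ K : Set RiemannSphere, K ⊆ U → IsCompact K →
      ∀ ε : ℝ, 0 < ε → ∃ N : ℕ, ∀ n : ℕ, N ≤ n → ∀ z ∈ K,
        sphericalDist (F (s (φ n)) z) (g z) < ε

/-- The Fatou set of `f`: the largest open set on which the family of iterates of `f` is normal,
that is, the union of all open sets on which it is normal (normality is a local property, by a
diagonal argument over a countable cover, so the family is normal on that union). -/
def fatouSet (f : RiemannSphere → RiemannSphere) : Set RiemannSphere :=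
  ⋃₀ {U : Set RiemannSphere | IsOpen U ∧ IsNormalOn (fun n : ℕ => f^[n]) U}

/-- The Julia set of `f`: the complement of the Fatou set. -/
def juliaSet (f : RiemannSphere → RiemannSphere) : Set RiemannSphere :=
  (fatouSet f)ᶜ

end RiemannSphere

/-! The argument is a double use of Zalcman rescaling. Let `p` be a Julia point of a non-constant
rational map `f`, not in the closure of the periodic points. By Arzelà–Ascoli the spherical
derivatives of the iterates are unbounded near `p`. Rescaling there (`exists_rescaling_limit`) gives
maps `w ↦ f^[n k] (x k + ρ k * w)`, read in a chart at `p`, that converge to a non-constant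
holomorphic `g : ℂ → RiemannSphere`, with `x k` tending to `p` and `ρ k` to `0`.

If `f^[m] (g w) = p` for some `m > 0`, compare the `f^[m]`-images of the rescaled maps with the
points `x k + ρ k * w` themselves: the former tend to `f^[m] ∘ g`, the latter to the constant `p`.
By Hurwitz (`eventually_exists_eq_of_tendstoContinuously`) the two agree somewhere near `w`, and a
point of agreement is a point near `p` fixed by `f^[m + n k]`. This is excluded, so `g` omits every
preimage of `p` of positive order. Since `p` is not periodic and `f` is surjective, a backward orbit
of `p` is infinite, so `g` omits three finite values and is constant by Picard, a contradiction.

Picard's theorem is itself obtained by rescaling. If `u` is entire, non-constant and omits `0` and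
`1`, its `2^k`-th roots omit more and more roots of unity. A rescaled limit of them is entire,
non-constant and omits all roots of unity of order a power of two; being open, it omits the unit
circle, against Liouville.

The size of the real derivative of `embed ∘ F` serves as spherical derivative, and `swap` reduces
each local question at `∞` to the finite plane. -/

namespace RiemannSphere

open Filter Topology Set Polynomial

/-! ### Homogeneous coordinates, stereographic embedding, chordal distance -/

/-- The point of the sphere with homogeneous coordinates `[a : b]`. -/
noncomputable def frac (a b : ℂ) : RiemannSphere :=
  open Classical in if b = 0 then OnePoint.infty else OnePoint.some (a / b)

theorem frac_zero (a : ℂ) : frac a 0 = OnePoint.infty := by simp [frac]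

theorem frac_of_ne {a b : ℂ} (hb : b ≠ 0) : frac a b = OnePoint.some (a / b) := by
  simp [frac, hb]

theorem frac_one (a : ℂ) : frac a 1 = OnePoint.some a := by simp [frac]

/-- The stereographic embedding of the Riemann sphere into `ℂ × ℝ`. -/
noncomputable def embed : RiemannSphere → ℂ × ℝ
  | OnePoint.some z => (2 * z / ((1 + ‖z‖ ^ 2 : ℝ) : ℂ), (‖z‖ ^ 2 - 1) / (1 + ‖z‖ ^ 2))
  | OnePoint.infty => (0, 1)

theorem embed_coe (z : ℂ) : embed (OnePoint.some z) =
    (2 * z / ((1 + ‖z‖ ^ 2 : ℝ) : ℂ), (‖z‖ ^ 2 - 1) / (1 + ‖z‖ ^ 2)) := rfl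

theorem embed_infty : embed OnePoint.infty = (0, 1) := rfl

theorem norm_sq_add_norm_sq_pos {a b : ℂ} (h : a ≠ 0 ∨ b ≠ 0) : 0 < ‖a‖ ^ 2 + ‖b‖ ^ 2 := by
  rcases h with h | h
  · have := norm_pos_iff.2 h
    positivity
  · have := norm_pos_iff.2 h
    positivity

/-- This form has no special case at `∞` and is real-smooth in `(a, b)` off the origin; continuity
at `∞` and differentiability at poles are read off from it. -/
theorem embed_frac {a b : ℂ} (h : a ≠ 0 ∨ b ≠ 0) : embed (frac a b) =
    (((‖a‖ ^ 2 + ‖b‖ ^ 2)⁻¹ : ℝ) • (2 * a * (starRingEnd ℂ) b),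
      (‖a‖ ^ 2 + ‖b‖ ^ 2)⁻¹ * (‖a‖ ^ 2 - ‖b‖ ^ 2)) := by
  by_cases hb : b = 0
  · subst hb
    have ha : ‖a‖ ≠ 0 := by simpa using h
    rw [frac_zero, embed_infty]
    ext1
    · simp
    · simp [ha]
  · rw [frac_of_ne hb, embed_coe]
    have hb' : ‖b‖ ≠ 0 := by simpa using hb
    have hp := norm_sq_add_norm_sq_pos h
    ext1
    · have h1 : ((‖b‖ ^ 2 : ℝ) : ℂ) = b * (starRingEnd ℂ) b := by
        rw [Complex.mul_conj, Complex.normSq_eq_norm_sq]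
      have h2 : ((‖a‖ ^ 2 + ‖b‖ ^ 2 : ℝ) : ℂ) ≠ 0 := by exact_mod_cast hp.ne'
      have h3 : ((1 + ‖a / b‖ ^ 2 : ℝ)) = (‖a‖ ^ 2 + ‖b‖ ^ 2) / ‖b‖ ^ 2 := by
        rw [norm_div]; field_simp; ring
      have h4 : (starRingEnd ℂ) b ≠ 0 := by simpa using hb
      simp only [Complex.real_smul]
      rw [h3, Complex.ofReal_div, h1, Complex.ofReal_inv]
      field_simp
    · simp only [norm_div]
      field_simp
      rw [add_comm]

theorem continuous_embed : Continuous embed := by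
  rw [OnePoint.continuous_iff]
  constructor
  · rw [coclosedCompact_eq_cocompact, ← Metric.cobounded_eq_cocompact]
    -- The embedding in the coordinate `b = 1 / z` at `∞`, that is, at `[1 : b]`.
    let G : ℂ → ℂ × ℝ := fun b => (((‖(1 : ℂ)‖ ^ 2 + ‖b‖ ^ 2)⁻¹ : ℝ) • (2 * 1 * (starRingEnd ℂ) b),
      (‖(1 : ℂ)‖ ^ 2 + ‖b‖ ^ 2)⁻¹ * (‖(1 : ℂ)‖ ^ 2 - ‖b‖ ^ 2))
    have hne : ∀ b : ℂ, ‖(1 : ℂ)‖ ^ 2 + ‖b‖ ^ 2 ≠ 0 := fun b => by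
      rw [norm_one]; positivity
    have hG : Continuous G := by
      have hc : Continuous (starRingEnd ℂ) := Complex.continuous_conj
      have hi : Continuous fun b : ℂ => (‖(1 : ℂ)‖ ^ 2 + ‖b‖ ^ 2)⁻¹ :=
        Continuous.inv₀ (by fun_prop) hne
      fun_prop
    have h0 : G 0 = embed OnePoint.infty := by simp [G, embed_infty]
    rw [← h0]
    refine ((hG.tendsto 0).comp tendsto_inv₀_cobounded).congr' ?_
    filter_upwards [Bornology.eventually_ne_cobounded (0 : ℂ)] with z hz
    have := embed_frac (a := 1) (b := z⁻¹) (Or.inl one_ne_zero)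
    rw [frac_of_ne (inv_ne_zero hz), one_div, inv_inv] at this
    exact this.symm
  · simp only [embed_coe]
    have hne : ∀ z : ℂ, (1 + ‖z‖ ^ 2 : ℝ) ≠ 0 := fun z => by positivity
    refine Continuous.prodMk ?_ ?_
    · exact Continuous.div (by fun_prop) (by fun_prop) fun z => by exact_mod_cast hne z
    · exact Continuous.div (by fun_prop) (by fun_prop) hne

theorem embed_injective : Function.Injective embed := by
  have key : ∀ z : ℂ, (embed (OnePoint.some z)).2 ≠ 1 := by
    intro z h
    simp only [embed_coe] at h
    rw [div_eq_iff (by positivity)] at h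
    linarith
  intro p q h
  induction p using OnePoint.rec with
  | infty =>
    induction q using OnePoint.rec with
    | infty => rfl
    | coe w => exact absurd (by rw [← h, embed_infty]) (key w)
  | coe z =>
    induction q using OnePoint.rec with
    | infty => exact absurd (by rw [h, embed_infty]) (key z)
    | coe w =>
      rw [embed_coe, embed_coe, Prod.mk.injEq] at h
      obtain ⟨h1, h2⟩ := h
      rw [div_eq_div_iff (by positivity) (by positivity)] at h2
      have h3 : ‖z‖ ^ 2 = ‖w‖ ^ 2 := by linarith
      rw [h3] at h1
      have h4 : ((1 + ‖w‖ ^ 2 : ℝ) : ℂ) ≠ 0 := by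
        have : (1 + ‖w‖ ^ 2 : ℝ) ≠ 0 := by positivity
        exact_mod_cast this
      rw [div_left_inj' h4] at h1
      rw [mul_right_injective₀ two_ne_zero h1]

theorem isClosedEmbedding_embed : IsClosedEmbedding embed :=
  continuous_embed.isClosedEmbedding embed_injective

theorem chordalDist_sq (p q : RiemannSphere) : chordalDist p q ^ 2 =
    ‖(embed p).1 - (embed q).1‖ ^ 2 + ((embed p).2 - (embed q).2) ^ 2 := by
  have hs : ∀ z : ℂ, √(1 + ‖z‖ ^ 2) ^ 2 = 1 + ‖z‖ ^ 2 := fun z => Real.sq_sqrt (by positivity)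
  have hne : ∀ z : ℂ, (1 + ‖z‖ ^ 2 : ℝ) ≠ 0 := fun z => by positivity
  have hn : ∀ z : ℂ, ‖2 * z / ((1 + ‖z‖ ^ 2 : ℝ) : ℂ)‖ ^ 2 = 4 * ‖z‖ ^ 2 / (1 + ‖z‖ ^ 2) ^ 2 := by
    intro z
    rw [norm_div, norm_mul, Complex.norm_real, Real.norm_of_nonneg (by positivity), div_pow,
      mul_pow, Complex.norm_two]
    norm_num
  induction p using OnePoint.rec with
  | infty =>
    induction q using OnePoint.rec with
    | infty => simp [chordalDist]
    | coe w =>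
      have := hne w
      rw [embed_infty, embed_coe, zero_sub, norm_neg, hn]
      simp only [chordalDist, div_pow, hs]
      field_simp
      ring
  | coe z =>
    induction q using OnePoint.rec with
    | infty =>
      have := hne z
      rw [embed_infty, embed_coe, sub_zero, hn]
      simp only [chordalDist, div_pow, hs]
      field_simp
      ring
    | coe w =>
      have h1 := hne z
      have h2 := hne w
      simp only [chordalDist, embed_coe, div_pow, mul_pow, hs]
      simp only [← Complex.normSq_eq_norm_sq, Complex.normSq_apply] at h1 h2 ⊢
      simp only [Complex.sub_re, Complex.sub_im, Complex.div_ofReal_re, Complex.div_ofReal_im,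
        Complex.mul_re, Complex.mul_im, Complex.re_ofNat, Complex.im_ofNat]
      field_simp
      ring

/-- The product metric on `ℂ × ℝ` is the sup metric, so the Euclidean length is at most `√2` times
it; the cruder factor `2` suffices. -/
theorem chordalDist_le (p q : RiemannSphere) :
    chordalDist p q ≤ 2 * dist (embed p) (embed q) := by
  refine le_of_sq_le_sq ?_ (by positivity)
  rw [chordalDist_sq, mul_pow]
  have h1 : ‖(embed p).1 - (embed q).1‖ ≤ dist (embed p) (embed q) := by
    rw [← dist_eq_norm]; exact le_max_left _ _
  have h2 : |(embed p).2 - (embed q).2| ≤ dist (embed p) (embed q) := by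
    rw [← Real.dist_eq]; exact le_max_right _ _
  have h3 := pow_le_pow_left₀ (norm_nonneg _) h1 2
  have h4 := pow_le_pow_left₀ (abs_nonneg _) h2 2
  rw [sq_abs] at h4
  nlinarith

theorem exists_sphericalDist_lt {ε : ℝ} (hε : 0 < ε) :
    ∃ δ > 0, ∀ p q : RiemannSphere, dist (embed p) (embed q) < δ → sphericalDist p q < ε := by
  have h : Tendsto (fun x : ℝ => 2 * Real.arcsin x) (𝓝 0) (𝓝 0) := by
    have : Continuous (fun x : ℝ => 2 * Real.arcsin x) := by fun_prop
    simpa using this.tendsto 0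
  obtain ⟨δ, hδ, h⟩ := Metric.eventually_nhds_iff.1 (h.eventually (gt_mem_nhds hε))
  refine ⟨δ / 2, by positivity, fun p q hpq => ?_⟩
  have h1 := h (y := δ / 2) (by rw [Real.dist_eq, sub_zero, abs_of_pos] <;> linarith)
  refine lt_of_le_of_lt ?_ h1
  have h2 := chordalDist_le p q
  have := Real.monotone_arcsin (show chordalDist p q / 2 ≤ δ / 2 by linarith)
  unfold sphericalDist
  linarith

/-! ### The inversion and the affine coordinate -/

/-- The inversion `z ↦ 1 / z` of the Riemann sphere. -/
noncomputable def swap : RiemannSphere → RiemannSphere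
  | OnePoint.some z => frac 1 z
  | OnePoint.infty => OnePoint.some 0

theorem frac_mul_left {c : ℂ} (hc : c ≠ 0) (a b : ℂ) : frac (c * a) (c * b) = frac a b := by
  by_cases hb : b = 0
  · simp [hb, frac_zero]
  · rw [frac_of_ne hb, frac_of_ne (mul_ne_zero hc hb), mul_div_mul_left _ _ hc]

theorem swap_frac {a b : ℂ} (h : a ≠ 0 ∨ b ≠ 0) : swap (frac a b) = frac b a := by
  by_cases hb : b = 0
  · subst hb
    have ha : a ≠ 0 := by simpa using h
    simp [frac_zero, swap, frac_of_ne ha]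
  · rw [frac_of_ne hb]
    change frac 1 (a / b) = _
    rw [← frac_mul_left hb, mul_one, mul_div_cancel₀ _ hb]

theorem exists_eq_frac (p : RiemannSphere) :
    ∃ a b : ℂ, (a ≠ 0 ∨ b ≠ 0) ∧ p = frac a b := by
  induction p using OnePoint.rec with
  | infty => exact ⟨1, 0, Or.inl one_ne_zero, (frac_zero 1).symm⟩
  | coe z => exact ⟨z, 1, Or.inr one_ne_zero, (frac_one z).symm⟩

theorem swap_swap (p : RiemannSphere) : swap (swap p) = p := by
  obtain ⟨a, b, h, rfl⟩ := exists_eq_frac p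
  rw [swap_frac h, swap_frac h.symm]

theorem swap_injective : Function.Injective swap :=
  Function.LeftInverse.injective swap_swap

theorem swap_infty : swap OnePoint.infty = OnePoint.some 0 := rfl

theorem swap_zero : swap (OnePoint.some 0) = OnePoint.infty := by
  rw [← swap_infty, swap_swap]

theorem embed_swap (p : RiemannSphere) :
    embed (swap p) = ((starRingEnd ℂ) (embed p).1, -(embed p).2) := by
  obtain ⟨a, b, h, rfl⟩ := exists_eq_frac p
  rw [swap_frac h, embed_frac h, embed_frac h.symm, add_comm]
  ext1
  · simp only [Complex.real_smul, map_mul, Complex.conj_ofReal, Complex.conj_conj,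
      Complex.conj_ofNat]
    ring
  · simp only
    ring

theorem continuous_swap : Continuous swap := by
  rw [isClosedEmbedding_embed.isInducing.continuous_iff]
  have : embed ∘ swap = fun p => ((starRingEnd ℂ) (embed p).1, -(embed p).2) :=
    funext embed_swap
  rw [this]
  have h1 := continuous_embed
  have h2 : Continuous (starRingEnd ℂ) := Complex.continuous_conj
  fun_prop

/-- The affine coordinate of a point of the sphere, with junk value `0` at `∞`. -/
noncomputable def toComplex (p : RiemannSphere) : ℂ := OnePoint.elim p 0 id

theorem toComplex_coe (z : ℂ) : toComplex (OnePoint.some z) = z := rfl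

theorem coe_toComplex {p : RiemannSphere} (hp : p ≠ OnePoint.infty) :
    OnePoint.some (toComplex p) = p := by
  induction p using OnePoint.rec with
  | infty => exact absurd rfl hp
  | coe z => rfl

theorem continuousAt_toComplex {p : RiemannSphere} (hp : p ≠ OnePoint.infty) :
    ContinuousAt toComplex p := by
  rw [← coe_toComplex hp, OnePoint.continuousAt_coe]
  exact (continuousAt_id (x := toComplex p))

/-! ### Holomorphic maps from the plane to the sphere -/

/-- A map from the plane to the Riemann sphere is holomorphic at `z` if near `z` it is given in
homogeneous coordinates by two analytic functions without common zero. -/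
def IsHoloAt (F : ℂ → RiemannSphere) (z : ℂ) : Prop :=
  ∃ u v : ℂ → ℂ, AnalyticAt ℂ u z ∧ AnalyticAt ℂ v z ∧ (u z ≠ 0 ∨ v z ≠ 0) ∧
    ∀ᶠ w in 𝓝 z, F w = frac (u w) (v w)

namespace IsHoloAt

variable {F : ℂ → RiemannSphere} {z : ℂ}

theorem coe {u : ℂ → ℂ} (hu : AnalyticAt ℂ u z) : IsHoloAt (fun w => OnePoint.some (u w)) z :=
  ⟨u, fun _ => 1, hu, analyticAt_const, Or.inr one_ne_zero, by simp [frac_one]⟩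

theorem eventually_ne {u v : ℂ → ℂ} (hu : AnalyticAt ℂ u z) (hv : AnalyticAt ℂ v z)
    (h : u z ≠ 0 ∨ v z ≠ 0) : ∀ᶠ w in 𝓝 z, u w ≠ 0 ∨ v w ≠ 0 := by
  rcases h with h | h
  · exact (hu.continuousAt.eventually_ne h).mono fun _ => Or.inl
  · exact (hv.continuousAt.eventually_ne h).mono fun _ => Or.inr

theorem congr {G : ℂ → RiemannSphere} (hF : IsHoloAt F z) (h : F =ᶠ[𝓝 z] G) : IsHoloAt G z := by
  obtain ⟨u, v, hu, hv, h0, he⟩ := hF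
  exact ⟨u, v, hu, hv, h0, by filter_upwards [h, he] with w h1 h2; rw [← h1, h2]⟩

theorem swap (hF : IsHoloAt F z) : IsHoloAt (fun w => swap (F w)) z := by
  obtain ⟨u, v, hu, hv, h, he⟩ := hF
  refine ⟨v, u, hv, hu, h.symm, ?_⟩
  filter_upwards [he, eventually_ne hu hv h] with w hw h'
  rw [hw, swap_frac h']

theorem comp {e : ℂ → ℂ} (hF : IsHoloAt F (e z)) (he : AnalyticAt ℂ e z) :
    IsHoloAt (fun w => F (e w)) z := by
  obtain ⟨u, v, hu, hv, h, h'⟩ := hF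
  exact ⟨fun w => u (e w), fun w => v (e w), hu.comp he, hv.comp he, h,
    he.continuousAt.eventually h'⟩

theorem contDiffAt (hF : IsHoloAt F z) : ContDiffAt ℝ 1 (fun w => embed (F w)) z := by
  obtain ⟨u, v, hu, hv, h, he⟩ := hF
  have hu' : ContDiffAt ℝ 1 u z := hu.contDiffAt.restrict_scalars ℝ
  have hv' : ContDiffAt ℝ 1 v z := hv.contDiffAt.restrict_scalars ℝ
  have hc : ContDiffAt ℝ 1 (fun w => (starRingEnd ℂ) (v w)) z :=
    Complex.conjCLE.contDiff.contDiffAt.comp z hv'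
  have hun := hu'.norm_sq ℝ
  have hvn := hv'.norm_sq ℝ
  have hi : ContDiffAt ℝ 1 (fun w => (‖u w‖ ^ 2 + ‖v w‖ ^ 2)⁻¹) z :=
    (hun.add hvn).inv (norm_sq_add_norm_sq_pos h).ne'
  have key := (hi.smul ((contDiffAt_const (c := (2 : ℂ)).mul hu').mul hc)).prodMk
    (hi.mul (hun.sub hvn))
  refine key.congr_of_eventuallyEq ?_
  filter_upwards [he, eventually_ne hu hv h] with w hw h'
  rw [hw, embed_frac h']
  rfl

theorem continuousAt (hF : IsHoloAt F z) : ContinuousAt F z :=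
  isClosedEmbedding_embed.isInducing.continuousAt_iff.2 hF.contDiffAt.continuousAt

theorem analyticAt_toComplex (hF : IsHoloAt F z) (hz : F z ≠ OnePoint.infty) :
    AnalyticAt ℂ (fun w => toComplex (F w)) z := by
  obtain ⟨u, v, hu, hv, h, he⟩ := hF
  have hvz : v z ≠ 0 := fun h0 => hz (by rw [he.self_of_nhds, h0, frac_zero])
  refine (hu.div hv hvz).congr ?_
  filter_upwards [he, hv.continuousAt.eventually_ne hvz] with w hw hvw
  rw [hw, frac_of_ne hvw, toComplex_coe, Pi.div_apply]

end IsHoloAt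

/-! ### Rational maps in homogeneous coordinates -/

/-- The value at `(u, v)` of the homogenization of degree `N` of a polynomial `p`. -/
noncomputable def homEval (N : ℕ) (p : ℂ[X]) (u v : ℂ) : ℂ :=
  ∑ i ∈ Finset.range (N + 1), p.coeff i * u ^ i * v ^ (N - i)

theorem homEval_of_ne {N : ℕ} {p : ℂ[X]} (hp : p.natDegree ≤ N) (u : ℂ) {v : ℂ} (hv : v ≠ 0) :
    homEval N p u v = v ^ N * p.eval (u / v) := by
  rw [homEval, eval_eq_sum_range' (Nat.lt_succ_of_le hp), Finset.mul_sum]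
  refine Finset.sum_congr rfl fun i hi => ?_
  have hi' : i ≤ N := Nat.lt_succ_iff.1 (Finset.mem_range.1 hi)
  obtain ⟨k, rfl⟩ := Nat.exists_eq_add_of_le hi'
  rw [Nat.add_sub_cancel_left, pow_add, div_pow]
  field_simp

theorem homEval_zero_right (N : ℕ) (p : ℂ[X]) (u : ℂ) : homEval N p u 0 = p.coeff N * u ^ N := by
  rw [homEval, Finset.sum_range_succ, Finset.sum_eq_zero, Nat.sub_self, pow_zero, mul_one,
    zero_add]
  intro i hi
  rw [zero_pow (Nat.sub_ne_zero_of_lt (Finset.mem_range.1 hi)), mul_zero]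

theorem analyticAt_homEval (N : ℕ) (p : ℂ[X]) {u v : ℂ → ℂ} {z : ℂ} (hu : AnalyticAt ℂ u z)
    (hv : AnalyticAt ℂ v z) : AnalyticAt ℂ (fun w => homEval N p (u w) (v w)) z := by
  unfold homEval
  fun_prop

section rationalMap

variable (R : RatFunc ℂ)

/-- The degree of a rational map. -/
noncomputable def ratDegree : ℕ := max R.num.natDegree R.denom.natDegree

theorem natDegree_num_le : R.num.natDegree ≤ ratDegree R := le_max_left _ _

theorem natDegree_denom_le : R.denom.natDegree ≤ ratDegree R := le_max_right _ _

theorem num_eval_ne_zero_or_denom_eval_ne_zero (z : ℂ) :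
    R.num.eval z ≠ 0 ∨ R.denom.eval z ≠ 0 := by
  obtain ⟨a, b, h⟩ := R.isCoprime_num_denom
  by_contra! h0
  have := congrArg (eval z) h
  simp [h0.1, h0.2] at this

/-- Away from `v = 0` this is coprimality. At `v = 0` only the coefficients of degree `ratDegree R`
survive, and one of them is a leading coefficient. -/
theorem homEval_num_ne_or_homEval_denom_ne {u v : ℂ} (h : u ≠ 0 ∨ v ≠ 0) :
    homEval (ratDegree R) R.num u v ≠ 0 ∨ homEval (ratDegree R) R.denom u v ≠ 0 := by
  by_cases hv : v = 0
  · subst hv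
    have hu : u ≠ 0 := by simpa using h
    simp only [homEval_zero_right]
    rcases le_or_gt R.num.natDegree R.denom.natDegree with hd | hd
    · right
      rw [ratDegree, max_eq_right hd]
      exact mul_ne_zero (leadingCoeff_ne_zero.2 R.denom_ne_zero) (pow_ne_zero _ hu)
    · left
      rw [ratDegree, max_eq_left hd.le]
      refine mul_ne_zero (leadingCoeff_ne_zero.2 fun h0 => ?_) (pow_ne_zero _ hu)
      simp [h0] at hd
  · rw [homEval_of_ne (natDegree_num_le R) u hv, homEval_of_ne (natDegree_denom_le R) u hv]
    refine (num_eval_ne_zero_or_denom_eval_ne_zero R (u / v)).imp ?_ ?_ <;>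
    exact fun h => mul_ne_zero (pow_ne_zero _ hv) h

theorem rationalMap_frac {u v : ℂ} (h : u ≠ 0 ∨ v ≠ 0) : rationalMap R (frac u v) =
    frac (homEval (ratDegree R) R.num u v) (homEval (ratDegree R) R.denom u v) := by
  by_cases hv : v = 0
  · subst hv
    have hu : u ≠ 0 := by simpa using h
    have huN := pow_ne_zero (ratDegree R) hu
    simp only [homEval_zero_right, frac_zero, rationalMap]
    rw [mul_comm, mul_comm _ (u ^ _), frac_mul_left huN]
    split_ifs with hd
    · rw [ratDegree, max_eq_left hd.le, coeff_eq_zero_of_natDegree_lt hd, frac_zero]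
    · rw [ratDegree, max_eq_right (not_lt.1 hd), frac_of_ne]
      · rfl
      · exact leadingCoeff_ne_zero.2 R.denom_ne_zero
  · rw [homEval_of_ne (natDegree_num_le R) u hv, homEval_of_ne (natDegree_denom_le R) u hv,
      frac_mul_left (pow_ne_zero _ hv), frac_of_ne hv]
    rfl

theorem IsHoloAt.rationalMap {F : ℂ → RiemannSphere} {z : ℂ} (hF : IsHoloAt F z) :
    IsHoloAt (fun w => rationalMap R (F w)) z := by
  obtain ⟨u, v, hu, hv, h, he⟩ := hF
  refine ⟨_, _, analyticAt_homEval (ratDegree R) R.num hu hv,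
    analyticAt_homEval (ratDegree R) R.denom hu hv, homEval_num_ne_or_homEval_denom_ne R h, ?_⟩
  filter_upwards [he, eventually_ne hu hv h] with w hw h'
  rw [hw, rationalMap_frac R h']

theorem IsHoloAt.iterate_rationalMap {F : ℂ → RiemannSphere} {z : ℂ} (hF : IsHoloAt F z)
    (n : ℕ) : IsHoloAt (fun w => (RiemannSphere.rationalMap R)^[n] (F w)) z := by
  induction n with
  | zero => exact hF
  | succ n ih =>
    simp only [Function.iterate_succ_apply']
    exact ih.rationalMap R

theorem continuous_of_isHoloAt {f : RiemannSphere → RiemannSphere}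
    (h : ∀ z, IsHoloAt (fun w => f (OnePoint.some w)) z)
    (h' : ∀ z, IsHoloAt (fun w => f (swap (OnePoint.some w))) z) : Continuous f := by
  have key : ∀ (g : RiemannSphere → RiemannSphere) (z : ℂ),
      IsHoloAt (fun w => g (OnePoint.some w)) z → ContinuousAt g (OnePoint.some z) :=
    fun g z hg => OnePoint.continuousAt_coe.2 hg.continuousAt
  rw [continuous_iff_continuousAt]
  intro p
  induction p using OnePoint.rec with
  | coe z => exact key f z (h z)
  | infty =>
    have h1 := key (fun p => f (swap p)) 0 (h' 0)
    have h2 : f = fun p => f (swap (swap p)) := by simp [swap_swap]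
    rw [h2]
    exact ContinuousAt.comp (f := swap) (g := fun p => f (swap p)) h1 continuous_swap.continuousAt

theorem continuous_rationalMap : Continuous (rationalMap R) :=
  continuous_of_isHoloAt (fun _ => (IsHoloAt.coe analyticAt_id).rationalMap R)
    fun _ => (IsHoloAt.coe analyticAt_id).swap.rationalMap R

theorem rationalMap_eq_of_eval_eq_zero {p : ℂ} {z : ℂ} (h : (R.num - C p * R.denom).eval z = 0) :
    rationalMap R (OnePoint.some z) = OnePoint.some p := by
  simp only [eval_sub, eval_mul, eval_C] at h
  have h1 : R.denom.eval z ≠ 0 := by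
    intro h2
    rcases num_eval_ne_zero_or_denom_eval_ne_zero R z with h3 | h3
    · rw [h2] at h; simp at h; exact h3 h
    · exact h3 h2
  simp only [rationalMap, h1, if_false]
  congr 1
  field_simp
  linear_combination h

theorem eval_eq_zero_of_rationalMap_eq {p z : ℂ}
    (h : rationalMap R (OnePoint.some z) = OnePoint.some p) :
    (R.num - C p * R.denom).eval z = 0 := by
  simp only [rationalMap] at h
  split_ifs at h with h1
  · exact absurd h (OnePoint.infty_ne_coe _)
  · rw [OnePoint.coe_eq_coe, div_eq_iff h1] at h
    simp [h]

theorem exists_rationalMap_eq_const (h : ratDegree R = 0) : ∃ p, ∀ z, rationalMap R z = p := by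
  have h1 : R.num.natDegree = 0 := Nat.le_zero.1 (h ▸ le_max_left _ _)
  have h2 : R.denom.natDegree = 0 := Nat.le_zero.1 (h ▸ le_max_right _ _)
  refine ⟨frac (R.num.coeff 0) (R.denom.coeff 0), fun z => ?_⟩
  obtain ⟨a, b, hab, rfl⟩ := exists_eq_frac z
  rw [rationalMap_frac R hab, h]
  simp [homEval]

/-- Otherwise the denominator divides the numerator; coprimality makes it a unit, and both degrees
vanish. -/
theorem num_sub_ne_zero (h : ratDegree R ≠ 0) (p : ℂ) : R.num - C p * R.denom ≠ 0 := by
  intro h0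
  have h1 : R.num = C p * R.denom := sub_eq_zero.1 h0
  have h2 : IsUnit R.denom := by
    have := R.isCoprime_num_denom
    rw [h1] at this
    exact this.isUnit_of_dvd' (Dvd.intro_left _ rfl) dvd_rfl
  have h3 := natDegree_eq_zero_of_isUnit h2
  have h4 : R.num.natDegree ≤ 0 := by rw [h1, ← h3]; exact natDegree_C_mul_le _ _
  exact h (by rw [ratDegree, h3, Nat.le_zero.1 h4, max_self])

theorem rationalMap_surjective (h : ratDegree R ≠ 0) :
    Function.Surjective (rationalMap R) := by
  intro p
  induction p using OnePoint.rec with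
  | infty =>
    by_cases hd : R.denom.natDegree = 0
    · refine ⟨OnePoint.infty, ?_⟩
      have : R.denom.natDegree < R.num.natDegree := by
        rw [ratDegree, hd] at h; rw [hd]; simpa [Nat.pos_iff_ne_zero] using h
      simp [rationalMap, this]
    · obtain ⟨z, hz⟩ := Complex.exists_root (natDegree_pos_iff_degree_pos.1 (Nat.pos_of_ne_zero hd))
      refine ⟨OnePoint.some z, ?_⟩
      simp [rationalMap, IsRoot.def.1 hz]
  | coe p =>
    -- A constant `R.num - C p * R.denom` need not have a root. In that case `R.num` and `C p *
    -- R.denom` agree in all positive degrees, and the value `p` is taken at `∞`.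
    by_cases hd : (R.num - C p * R.denom).natDegree = 0
    · refine ⟨OnePoint.infty, ?_⟩
      obtain ⟨c, hc⟩ := natDegree_eq_zero.1 hd
      have h1 : R.num = C c + C p * R.denom := by rw [hc]; ring
      have h2 : R.num.natDegree ≤ R.denom.natDegree := by
        rw [h1, natDegree_C_add]; exact natDegree_C_mul_le _ _
      have h3 : R.denom.natDegree ≠ 0 := by
        rwa [ratDegree, max_eq_right h2] at h
      have h4 : R.num.coeff R.denom.natDegree = p * R.denom.leadingCoeff := by
        rw [h1, coeff_add, coeff_C_of_ne_zero h3, zero_add, coeff_C_mul]; rfl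
      have h5 : R.denom.leadingCoeff ≠ 0 := leadingCoeff_ne_zero.2 R.denom_ne_zero
      simp only [rationalMap, not_lt.2 h2, if_false]
      rw [h4, mul_div_cancel_right₀ _ h5]
    · obtain ⟨z, hz⟩ := Complex.exists_root (natDegree_pos_iff_degree_pos.1 (Nat.pos_of_ne_zero hd))
      exact ⟨OnePoint.some z, rationalMap_eq_of_eval_eq_zero R hz⟩

theorem finite_preimage_rationalMap (h : ratDegree R ≠ 0) (p : RiemannSphere) :
    (rationalMap R ⁻¹' {p}).Finite := by
  have key : ∀ q : ℂ[X], q ≠ 0 →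
      (∀ z, rationalMap R (OnePoint.some z) = p → q.eval z = 0) →
      (rationalMap R ⁻¹' {p}).Finite := by
    intro q hq hz
    refine (((q.rootSet_finite ℂ).image OnePoint.some).insert OnePoint.infty).subset ?_
    intro w hw
    induction w using OnePoint.rec with
    | infty => exact mem_insert _ _
    | coe w =>
      refine mem_insert_of_mem _ (mem_image_of_mem _ ?_)
      rw [mem_rootSet]
      exact ⟨hq, by simpa using hz w hw⟩
  induction p using OnePoint.rec with
  | infty =>
    refine key R.denom R.denom_ne_zero fun z hz => ?_
    by_contra h1
    simp [rationalMap, h1] at hz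
  | coe p => exact key _ (num_sub_ne_zero R h p) fun z hz => eval_eq_zero_of_rationalMap_eq R hz

theorem finite_preimage_iterate_rationalMap (h : ratDegree R ≠ 0) (n : ℕ) (p : RiemannSphere) :
    ((rationalMap R)^[n] ⁻¹' {p}).Finite := by
  induction n with
  | zero => simp
  | succ n ih =>
    rw [Function.iterate_succ, preimage_comp]
    rw [← biUnion_preimage_singleton]
    exact ih.biUnion fun q _ => finite_preimage_rationalMap R h q

end rationalMap

end RiemannSphere

/-! ### Continuous convergence -/

namespace RiemannSphere

open Filter Topology Set Metric

/-- Continuous convergence of a family of maps of the plane along a filter: jointly in the index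
and the point. For maps into a compact space this is locally uniform convergence. -/
def TendstoContinuously {ι X : Type*} [TopologicalSpace X] (l : Filter ι) (G : ι → ℂ → X)
    (g : ℂ → X) : Prop :=
  ∀ x, Tendsto (fun p : ι × ℂ => G p.1 p.2) (l ×ˢ 𝓝 x) (𝓝 (g x))

theorem tendsto_of_tendsto_prod_nhds {ι X : Type*} [TopologicalSpace X] {l : Filter ι}
    {G : ι → ℂ → X} {a : X} {x : ℂ}
    (h : Tendsto (fun p : ι × ℂ => G p.1 p.2) (l ×ˢ 𝓝 x) (𝓝 a)) :
    Tendsto (fun k => G k x) l (𝓝 a) :=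
  h.comp (tendsto_id.prodMk tendsto_const_nhds)

theorem continuousAt_of_tendsto_prod_nhds {ι X : Type*} [TopologicalSpace X] [RegularSpace X]
    {l : Filter ι} [l.NeBot] {G : ι → ℂ → X} {g : ℂ → X} {x : ℂ}
    (h : Tendsto (fun p : ι × ℂ => G p.1 p.2) (l ×ˢ 𝓝 x) (𝓝 (g x)))
    (h' : ∀ᶠ y in 𝓝 x, Tendsto (fun k => G k y) l (𝓝 (g y))) : ContinuousAt g x := by
  refine (closed_nhds_basis (g x)).tendsto_right_iff.2 fun V hV => ?_
  have h1 : ∀ᶠ p in 𝓝 x ×ˢ l, G p.2 p.1 ∈ V :=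
    (h.comp tendsto_prod_swap) hV.1
  filter_upwards [h1.curry, h'] with y hy hy'
  exact hV.2.mem_of_tendsto hy' hy

theorem tendstoLocallyUniformlyOn_of_tendsto_prod_nhds {ι X : Type*} [UniformSpace X]
    {l : Filter ι} [l.NeBot] {G : ι → ℂ → X} {g : ℂ → X} {s : Set ℂ} (hs : IsOpen s)
    (h : ∀ x ∈ s, Tendsto (fun p : ι × ℂ => G p.1 p.2) (l ×ˢ 𝓝 x) (𝓝 (g x))) :
    TendstoLocallyUniformlyOn G g l s := by
  rw [hs.tendstoLocallyUniformlyOn_iff_forall_tendsto]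
  intro x hx
  have hc : ContinuousAt g x := by
    refine continuousAt_of_tendsto_prod_nhds (h x hx) ?_
    filter_upwards [hs.mem_nhds hx] with y hy
    exact tendsto_of_tendsto_prod_nhds (h y hy)
  have h1 : Tendsto (fun p : ι × ℂ => g p.2) (l ×ˢ 𝓝 x) (𝓝 (g x)) := hc.tendsto.comp tendsto_snd
  have h2 := (h1.prodMk_nhds (h x hx))
  rw [nhds_prod_eq] at h2
  exact h2.mono_right (nhds_le_uniformity (g x) |> fun hle => by rwa [nhds_prod_eq] at hle)

namespace TendstoContinuously

variable {ι X Y : Type*} [TopologicalSpace X] [TopologicalSpace Y] {l : Filter ι}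
  {G : ι → ℂ → X} {g : ℂ → X}

theorem tendsto (h : TendstoContinuously l G g) (x : ℂ) : Tendsto (fun k => G k x) l (𝓝 (g x)) :=
  tendsto_of_tendsto_prod_nhds (h x)

theorem continuous [RegularSpace X] [l.NeBot] (h : TendstoContinuously l G g) : Continuous g :=
  continuous_iff_continuousAt.2 fun x =>
    continuousAt_of_tendsto_prod_nhds (h x) (Eventually.of_forall h.tendsto)

theorem comp_left (h : TendstoContinuously l G g) {f : X → Y} (hf : Continuous f) :
    TendstoContinuously l (fun k w => f (G k w)) (fun w => f (g w)) :=
  fun x => (hf.tendsto _).comp (h x)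

theorem swap {G : ι → ℂ → RiemannSphere} {g : ℂ → RiemannSphere}
    (hg : TendstoContinuously l G g) :
    TendstoContinuously l (fun k w => swap (G k w)) (fun w => swap (g w)) :=
  hg.comp_left continuous_swap

end TendstoContinuously

/-! ### Limits of holomorphic maps and Hurwitz's theorem -/

section Limits

variable {ι : Type*} {l : Filter ι} [l.NeBot] {G H : ι → ℂ → RiemannSphere}
  {g h : ℂ → RiemannSphere}

/-- Joint convergence in index and point keeps almost all `G k` away from `∞` on one common ball,
where the classical theory of locally uniform limits applies to the affine coordinates. -/
theorem exists_ball_tendstoLocallyUniformlyOn (hG : ∀ k z, IsHoloAt (G k) z)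
    (hg : TendstoContinuously l G g) {x : ℂ} (hx : g x ≠ OnePoint.infty) :
    ∃ r > 0, (∀ᶠ k in l, (∀ w ∈ ball x r, G k w ≠ OnePoint.infty) ∧
        DifferentiableOn ℂ (fun w => toComplex (G k w)) (ball x r)) ∧
      (∀ w ∈ ball x r, g w ≠ OnePoint.infty) ∧
      TendstoLocallyUniformlyOn (fun k w => toComplex (G k w)) (fun w => toComplex (g w)) l
        (ball x r) := by
  have h1 := (hg x).eventually (isOpen_ne.mem_nhds hx)
  obtain ⟨P, hP, Q, hQ, hPQ⟩ := eventually_prod_iff.1 h1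
  have h2 := hg.continuous.continuousAt.eventually (isOpen_ne.mem_nhds hx)
  obtain ⟨r, hr, hball⟩ := Metric.eventually_nhds_iff_ball.1 (hQ.and h2)
  refine ⟨r, hr, ?_, fun w hw => (hball w hw).2, ?_⟩
  · filter_upwards [hP] with k hk
    have h3 : ∀ w ∈ ball x r, G k w ≠ OnePoint.infty := fun w hw => hPQ hk (hball w hw).1
    exact ⟨h3, fun w hw =>
      ((hG k w).analyticAt_toComplex (h3 w hw)).differentiableAt.differentiableWithinAt⟩
  · refine tendstoLocallyUniformlyOn_of_tendsto_prod_nhds isOpen_ball fun w hw => ?_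
    exact (continuousAt_toComplex (hball w hw).2).tendsto.comp (hg w)

theorem swap_ne_infty {p : RiemannSphere} (hp : p = OnePoint.infty) :
    RiemannSphere.swap p ≠ OnePoint.infty := by
  rw [hp, swap_infty]; exact OnePoint.coe_ne_infty 0

theorem IsHoloAt.of_tendstoContinuously (hG : ∀ k z, IsHoloAt (G k) z)
    (hg : TendstoContinuously l G g) (x : ℂ) : IsHoloAt g x := by
  have key : ∀ (G : ι → ℂ → RiemannSphere) (g : ℂ → RiemannSphere), (∀ k z, IsHoloAt (G k) z) →
      TendstoContinuously l G g → g x ≠ OnePoint.infty → IsHoloAt g x := by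
    intro G g hG hg hx
    obtain ⟨r, hr, h1, h2, h3⟩ := exists_ball_tendstoLocallyUniformlyOn hG hg hx
    have h4 := h3.differentiableOn (h1.mono fun k hk => hk.2) isOpen_ball
    have h5 := h4.analyticAt (isOpen_ball.mem_nhds (mem_ball_self hr))
    refine (IsHoloAt.coe h5).congr ?_
    filter_upwards [isOpen_ball.mem_nhds (mem_ball_self hr)] with w hw
    exact coe_toComplex (h2 w hw)
  by_cases hx : g x = OnePoint.infty
  · have := (key _ _ (fun k z => (hG k z).swap) hg.swap (swap_ne_infty hx)).swap
    simpa only [swap_swap] using! this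
  · exact key G g hG hg hx

theorem norm_fderiv_comp_le {E : Type*} [NormedAddCommGroup E] [NormedSpace ℝ E] {S : ℂ → E}
    {u : ℂ → ℂ} {z : ℂ} (hS : DifferentiableAt ℝ S (u z)) (hu : DifferentiableAt ℂ u z) :
    ‖fderiv ℝ (fun w => S (u w)) z‖ ≤ ‖fderiv ℝ S (u z)‖ * ‖deriv u z‖ := by
  have h1 := (hu.hasFDerivAt.restrictScalars ℝ)
  have h2 := (hS.hasFDerivAt.comp z h1).fderiv
  have h3 : (fun w => S (u w)) = S ∘ u := rfl
  rw [h3, h2]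
  refine (ContinuousLinearMap.opNorm_comp_le _ _).trans ?_
  rw [ContinuousLinearMap.norm_restrictScalars, ← norm_deriv_eq_norm_fderiv]

/-- Near a finite constant limit the affine coordinates have derivatives tending to `0` at `x`, so
by the chain rule the spherical derivatives at `x` would tend to `0` as well. An involution `c` (the
identity or `swap`) makes the constant finite. -/
theorem not_const_of_norm_fderiv_embed_eq_one (hG : ∀ k z, IsHoloAt (G k) z)
    (hg : TendstoContinuously l G g) (x : ℂ)
    (hd : ∀ k, ‖fderiv ℝ (fun w => embed (G k w)) x‖ = 1) (p : RiemannSphere) :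
    ¬ ∀ w, g w = p := by
  intro hp
  have key : ∀ (c : RiemannSphere → RiemannSphere),
      (∀ F : ℂ → RiemannSphere, ∀ z, IsHoloAt F z → IsHoloAt (fun w => c (F w)) z) →
      Continuous c → (∀ q, c (c q) = q) → c p ≠ OnePoint.infty → False := by
    intro c hc hc' hcc hcp
    have hcg := hg.comp_left hc'
    simp only [hp] at hcg
    obtain ⟨r, hr, h1, h2, h3⟩ := exists_ball_tendstoLocallyUniformlyOn (x := x)
      (fun k z => hc _ _ (hG k z)) hcg hcp
    have hxr : x ∈ ball x r := mem_ball_self hr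
    set u : ι → ℂ → ℂ := fun k w => toComplex (c (G k w)) with hu
    have h4 : Tendsto (fun k => ‖deriv (u k) x‖) l (𝓝 0) := by
      have := ((h3.deriv (h1.mono fun k hk => hk.2) isOpen_ball).tendsto_at hxr).norm
      simpa using this
    set S : ℂ → ℂ × ℝ := fun z => embed (c (OnePoint.some z)) with hS
    have hSd : ContDiff ℝ 1 S := contDiff_iff_contDiffAt.2 fun z =>
      (hc _ _ (IsHoloAt.coe analyticAt_id)).contDiffAt
    have h5 : Tendsto (fun k => ‖fderiv ℝ S (u k x)‖) l (𝓝 ‖fderiv ℝ S (toComplex (c p))‖) :=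
      ((hSd.continuous_fderiv one_ne_zero).norm.tendsto _).comp (h3.tendsto_at hxr)
    have h6 := h5.mul h4
    rw [mul_zero] at h6
    have h7 := h6.eventually (gt_mem_nhds one_pos)
    obtain ⟨k, hk1, hk2⟩ := (h1.and h7).exists
    have h8 : ‖fderiv ℝ (fun w => S (u k w)) x‖ = 1 := by
      rw [← hd k]
      congr 1
      refine Filter.EventuallyEq.fderiv_eq ?_
      filter_upwards [isOpen_ball.mem_nhds hxr] with w hw
      simp only [hS, hu]
      rw [coe_toComplex (hk1.1 w hw), hcc]
    have h9 := norm_fderiv_comp_le (hSd.differentiable one_ne_zero (u k x))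
      (hk1.2.differentiableAt (isOpen_ball.mem_nhds hxr))
    rw [h8] at h9
    exact absurd hk2 (not_lt.2 h9)
  by_cases hpi : p = OnePoint.infty
  · exact key RiemannSphere.swap (fun F z hF => hF.swap) continuous_swap swap_swap
      (swap_ne_infty hpi)
  · exact key id (fun F z hF => hF) continuous_id (fun q => rfl) hpi

/-- A quantitative open mapping theorem replaces Rouché: a lower bound for `u k - u k x` on a small
circle forces the image of the disc to contain a fixed ball about `u k x`, and `u k x` tends to `0`.
-/
theorem exists_eq_of_tendstoLocallyUniformlyOn_zero {u : ι → ℂ → ℂ} {v : ℂ → ℂ} {x : ℂ} {r : ℝ}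
    (hr : 0 < r) (hu : ∀ᶠ k in l, DifferentiableOn ℂ (u k) (ball x r))
    (hv : TendstoLocallyUniformlyOn u v l (ball x r)) (h0 : v x = 0)
    (hne : ¬ ∀ᶠ w in 𝓝 x, v w = 0) : ∀ᶠ k in l, ∃ w ∈ ball x r, u k w = 0 := by
  have hvd := hv.differentiableOn hu isOpen_ball
  have hva := hvd.analyticAt (isOpen_ball.mem_nhds (mem_ball_self hr))
  have h1 := hva.eventually_eq_zero_or_eventually_ne_zero.resolve_left hne
  obtain ⟨t, ht, h2⟩ := Metric.eventually_nhds_iff_ball.1 (eventually_nhdsWithin_iff.1 h1)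
  obtain ⟨s, hs0, hs⟩ := exists_between (lt_min hr ht)
  have hsr : s < r := hs.trans_le (min_le_left _ _)
  have hst : s < t := hs.trans_le (min_le_right _ _)
  have hsub : closedBall x s ⊆ ball x r := closedBall_subset_ball hsr
  have hsne : (sphere x s).Nonempty := NormedSpace.sphere_nonempty.2 hs0.le
  have hcont : ContinuousOn v (sphere x s) :=
    hvd.continuousOn.mono (sphere_subset_closedBall.trans hsub)
  obtain ⟨y, hy, hmin⟩ := (isCompact_sphere x s).exists_isMinOn hsne hcont.norm
  have hyne : 0 < ‖v y‖ := by
    refine norm_pos_iff.2 (h2 y (sphere_subset_ball hst hy) ?_)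
    rintro rfl
    simp at hy
    exact hs0.ne hy
  set ε := ‖v y‖
  have hunif := (tendstoLocallyUniformlyOn_iff_forall_isCompact isOpen_ball).1 hv _ hsub
    (isCompact_closedBall x s)
  -- With errors below `ε / 4`, `u k - u k x` has size at least `ε / 2` on the circle. The image
  -- then contains the ball of radius `ε / 4` about `u k x`, and `0` lies in it.
  have h3 := Metric.tendstoUniformlyOn_iff.1 hunif (ε / 4) (by positivity)
  filter_upwards [h3, hu] with k hk hkd
  have hx := hk x (mem_closedBall_self hs0.le)
  rw [h0, dist_zero_left] at hx
  have hsph : ∀ z ∈ sphere x s, ε / 2 ≤ ‖u k z - u k x‖ := by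
    intro z hz
    have h4 := hk z (sphere_subset_closedBall hz)
    have h5 : ε ≤ ‖v z‖ := hmin hz
    rw [dist_eq_norm] at h4
    have h6 : ‖v z‖ ≤ ‖v z - u k z‖ + ‖u k z - u k x‖ + ‖u k x‖ := by
      calc ‖v z‖ = ‖(v z - u k z) + (u k z - u k x) + u k x‖ := by congr 1; ring
        _ ≤ _ := norm_add₃_le
    linarith
  have hcl : DiffContOnCl ℂ (u k) (ball x s) := by
    refine DifferentiableOn.diffContOnCl (hkd.mono ?_)
    exact closure_ball_subset_closedBall.trans hsub
  have hfreq : ∃ᶠ z in 𝓝 x, u k z ≠ u k x := by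
    intro hev
    have hev' : u k =ᶠ[𝓝 x] fun _ => u k x := hev.mono fun z hz => not_not.1 hz
    have h7 := (hkd.analyticOnNhd isOpen_ball).eqOn_of_preconnected_of_eventuallyEq
      analyticOnNhd_const (convex_ball x r).isPreconnected (mem_ball_self hr) hev'
    obtain ⟨z, hz⟩ := hsne
    have h8 := hsph z hz
    have h9 : u k z = u k x := h7 (hsub (sphere_subset_closedBall hz))
    rw [h9, sub_self, norm_zero] at h8
    linarith
  obtain ⟨w, hw, hw0⟩ := hcl.ball_subset_image_closedBall hs0 hsph hfreq
    (show (0 : ℂ) ∈ ball (u k x) (ε / 2 / 2) by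
      rw [mem_ball, dist_zero_left]; linarith)
  exact ⟨w, hsub hw, hw0⟩

/-- **Hurwitz's theorem** for maps to the Riemann sphere: a solution of `g = h`, isolated in the
sense that `g ≠ h` near it, is approximated by solutions of `G k = H k`. -/
theorem eventually_exists_eq_of_tendstoContinuously (hG : ∀ k z, IsHoloAt (G k) z)
    (hH : ∀ k z, IsHoloAt (H k) z) (hg : TendstoContinuously l G g)
    (hh : TendstoContinuously l H h) {x : ℂ} (hx : g x = h x)
    (hne : ¬ ∀ᶠ w in 𝓝 x, g w = h w) {r : ℝ} (hr : 0 < r) :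
    ∀ᶠ k in l, ∃ w ∈ ball x r, G k w = H k w := by
  have key : ∀ (G H : ι → ℂ → RiemannSphere) (g h : ℂ → RiemannSphere),
      (∀ k z, IsHoloAt (G k) z) → (∀ k z, IsHoloAt (H k) z) →
      TendstoContinuously l G g → TendstoContinuously l H h → g x = h x →
      (¬ ∀ᶠ w in 𝓝 x, g w = h w) → g x ≠ OnePoint.infty →
      ∀ᶠ k in l, ∃ w ∈ ball x r, G k w = H k w := by
    intro G H g h hG hH hg hh hx hne hxi
    obtain ⟨r₁, hr₁, h1, h2, h3⟩ := exists_ball_tendstoLocallyUniformlyOn hG hg hxi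
    obtain ⟨r₂, hr₂, h1', h2', h3'⟩ := exists_ball_tendstoLocallyUniformlyOn hH hh (hx ▸ hxi)
    set s := min r (min r₁ r₂) with hs
    have hs0 : 0 < s := lt_min hr (lt_min hr₁ hr₂)
    have hs1 : ball x s ⊆ ball x r₁ := ball_subset_ball ((min_le_right _ _).trans (min_le_left _ _))
    have hs2 : ball x s ⊆ ball x r₂ :=
      ball_subset_ball ((min_le_right _ _).trans (min_le_right _ _))
    have h4 := exists_eq_of_tendstoLocallyUniformlyOn_zero (l := l)
      (u := fun k w => toComplex (G k w) - toComplex (H k w))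
      (v := fun w => toComplex (g w) - toComplex (h w)) hs0
      (by filter_upwards [h1, h1'] with k hk hk'
          exact (hk.2.mono hs1).sub (hk'.2.mono hs2))
      ((h3.mono hs1).sub (h3'.mono hs2)) (by simp only [hx, sub_self])
      (by
        refine fun hev => hne ?_
        filter_upwards [hev, isOpen_ball.mem_nhds (mem_ball_self hs0)] with w hw hws
        rw [← coe_toComplex (h2 w (hs1 hws)), ← coe_toComplex (h2' w (hs2 hws)), sub_eq_zero.1 hw])
    filter_upwards [h4, h1, h1'] with k hk hk1 hk2
    obtain ⟨w, hw, hw0⟩ := hk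
    refine ⟨w, ball_subset_ball (min_le_left _ _) hw, ?_⟩
    rw [← coe_toComplex (hk1.1 w (hs1 hw)), ← coe_toComplex (hk2.1 w (hs2 hw)), sub_eq_zero.1 hw0]
  by_cases hxi : g x = OnePoint.infty
  · have := key _ _ _ _ (fun k z => (hG k z).swap) (fun k z => (hH k z).swap) hg.swap hh.swap
      (congrArg _ hx) (by simpa only [swap_injective.eq_iff] using! hne) (swap_ne_infty hxi)
    simpa only [swap_injective.eq_iff] using! this
  · exact key G H g h hG hH hg hh hx hne hxi

end Limits

/-! ### The identity theorem -/

section Identity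

variable {g : ℂ → RiemannSphere}

theorem IsHoloAt.eventually_eq_or_eventually_ne {z : ℂ} (hg : IsHoloAt g z) (p : RiemannSphere) :
    (∀ᶠ w in 𝓝 z, g w = p) ∨ ∀ᶠ w in 𝓝[≠] z, g w ≠ p := by
  have key : ∀ (g : ℂ → RiemannSphere) (p : RiemannSphere), IsHoloAt g z → p ≠ OnePoint.infty →
      (∀ᶠ w in 𝓝 z, g w = p) ∨ ∀ᶠ w in 𝓝[≠] z, g w ≠ p := by
    intro g p hg hp
    by_cases hz : g z = p
    · have h1 := hg.analyticAt_toComplex (hz ▸ hp)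
      have h2 : ∀ᶠ w in 𝓝 z, g w ≠ OnePoint.infty :=
        hg.continuousAt.eventually (isOpen_ne.mem_nhds (hz ▸ hp))
      refine (h1.eventually_eq_or_eventually_ne (analyticAt_const (v := toComplex p))).imp ?_ ?_
      · intro h3
        filter_upwards [h2, h3] with w hw hw'
        rw [← coe_toComplex hw, hw', coe_toComplex hp]
      · exact fun h3 => h3.mono fun w hw hw' => hw (by rw [hw'])
    · exact Or.inr (nhdsWithin_le_nhds (hg.continuousAt.eventually (isOpen_ne.mem_nhds hz)))
  by_cases hp : p = OnePoint.infty
  · have := key _ _ hg.swap (swap_ne_infty hp)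
    simpa only [swap_injective.eq_iff, ne_eq] using! this
  · exact key g p hg hp

theorem eq_of_eventually_eq_of_isHoloAt (hg : ∀ z, IsHoloAt g z) {p : RiemannSphere} {x : ℂ}
    (hx : ∀ᶠ w in 𝓝 x, g w = p) (z : ℂ) : g z = p := by
  have hopen : IsOpen {w | ∀ᶠ y in 𝓝 w, g y = p} := by
    rw [isOpen_iff_eventually]
    exact fun w hw => eventually_eventually_nhds.2 hw
  have hclosed : IsClosed {w | ∀ᶠ y in 𝓝 w, g y = p} := by
    rw [← isOpen_compl_iff, isOpen_iff_eventually]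
    intro w hw
    have h1 := ((hg w).eventually_eq_or_eventually_ne p).resolve_left hw
    rw [eventually_nhdsWithin_iff] at h1
    filter_upwards [h1] with y hy hyS
    by_cases hyw : y = w
    · exact hw (hyw ▸ hyS)
    · exact hy hyw hyS.self_of_nhds
  have huniv := IsClopen.eq_univ ⟨hclosed, hopen⟩ ⟨x, hx⟩
  have : z ∈ {w | ∀ᶠ y in 𝓝 w, g y = p} := huniv ▸ mem_univ z
  exact this.self_of_nhds

end Identity

end RiemannSphere

/-! ### Zalcman's rescaling lemma -/

namespace RiemannSphere

open Filter Topology Set Metric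

theorem norm_fderiv_embed_comp_affine {F : ℂ → RiemannSphere} (hF : ∀ z, IsHoloAt F z) (x : ℂ)
    {ρ : ℝ} (hρ : 0 ≤ ρ) (w : ℂ) :
    ‖fderiv ℝ (fun y => embed (F (x + ρ * y))) w‖ =
      ρ * ‖fderiv ℝ (fun y => embed (F y)) (x + ρ * w)‖ := by
  have h1 : HasFDerivAt (fun y : ℂ => x + ρ * y) (ρ • ContinuousLinearMap.id ℝ ℂ) w := by
    simpa only [id_eq, Complex.real_smul] using!
      ((hasFDerivAt_id (𝕜 := ℝ) w).const_smul ρ).const_add x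
  have h2 := ((hF (x + ρ * w)).contDiffAt.differentiableAt one_ne_zero).hasFDerivAt
  have h3 := (h2.comp w h1).fderiv
  have h4 : ((fun y => embed (F y)) ∘ fun y : ℂ => x + ρ * y) =
    fun y => embed (F (x + ρ * y)) := rfl
  rw [h4] at h3
  rw [h3, ContinuousLinearMap.comp_smul, ContinuousLinearMap.comp_id, norm_smul,
    Real.norm_of_nonneg hρ]

theorem dist_embed_le {F : ℂ → RiemannSphere} (hF : ∀ z, IsHoloAt F z) {s : Set ℂ}
    (hs : Convex ℝ s) {C : ℝ} (hC : ∀ z ∈ s, ‖fderiv ℝ (fun y => embed (F y)) z‖ ≤ C) {z w : ℂ}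
    (hz : z ∈ s) (hw : w ∈ s) : dist (embed (F w)) (embed (F z)) ≤ C * dist w z := by
  rw [dist_eq_norm, dist_eq_norm]
  exact hs.norm_image_sub_le_of_norm_fderiv_le (𝕜 := ℝ) (f := fun y => embed (F y))
    (fun y _ => (hF y).contDiffAt.differentiableAt one_ne_zero) hC hz hw

/-- Maps that are eventually equi-Lipschitz on each disc converge continuously along
ultrafilters. -/
theorem exists_tendstoContinuously {l : Ultrafilter ℕ} (hl : (l : Filter ℕ) ≤ atTop)
    {G : ℕ → ℂ → RiemannSphere} {C : ℝ} (hC : 0 < C)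
    (hG : ∀ k : ℕ, ∀ z ∈ ball (0 : ℂ) k, ∀ w ∈ ball (0 : ℂ) k,
      dist (embed (G k w)) (embed (G k z)) ≤ C * dist w z) :
    ∃ g, TendstoContinuously (l : Filter ℕ) G g := by
  -- On the compact sphere an ultrafilter gives all pointwise limits at once, with no diagonal
  -- extraction.
  have h1 : ∀ w, ∃ p, Tendsto (fun k => G k w) l (𝓝 p) := by
    intro w
    obtain ⟨p, -, hp⟩ := isCompact_univ.ultrafilter_le_nhds (l.map fun k => G k w) (by simp)
    exact ⟨p, hp⟩
  choose g hg using h1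
  refine ⟨g, fun w₀ => ?_⟩
  rw [isClosedEmbedding_embed.isInducing.tendsto_nhds_iff, Metric.tendsto_nhds]
  intro ε hε
  have h2 := Metric.tendsto_nhds.1 ((continuous_embed.tendsto _).comp (hg w₀)) (ε / 2)
    (by positivity)
  obtain ⟨N, hN⟩ := exists_nat_gt (‖w₀‖ + 1)
  have h3 := h2.and (hl (eventually_ge_atTop N))
  have h4 : ∀ᶠ w in 𝓝 w₀, dist w w₀ < min 1 (ε / (2 * C)) :=
    Metric.ball_mem_nhds w₀ (by positivity)
  filter_upwards [h3.prod_mk h4] with p hp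
  obtain ⟨⟨hp1, hp2⟩, hp3⟩ := hp
  have hNk : (N : ℝ) ≤ p.1 := by exact_mod_cast hp2
  have hw₀ : w₀ ∈ ball (0 : ℂ) p.1 := by
    rw [mem_ball_zero_iff]; linarith
  have hd1 := hp3.trans_le (min_le_left _ _)
  have hd2 := hp3.trans_le (min_le_right _ _)
  have hw : p.2 ∈ ball (0 : ℂ) p.1 := by
    rw [mem_ball, dist_zero_right]
    have h5 := norm_le_norm_add_norm_sub' p.2 w₀
    rw [dist_eq_norm] at hd1
    linarith
  have h6 := hG p.1 w₀ hw₀ p.2 hw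
  have h7 : C * dist p.2 w₀ < ε / 2 := by
    rw [lt_div_iff₀ (by positivity)] at hd2
    linarith
  have h8 := dist_triangle (embed (G p.1 p.2)) (embed (G p.1 w₀)) (embed (g w₀))
  simp only [Function.comp_apply] at hp1 ⊢
  linarith

/-- **Zalcman's rescaling lemma**: if the spherical derivatives of holomorphic maps from the plane
to the sphere blow up near a point, then suitable rescalings near this point converge to a
non-constant holomorphic map. -/
theorem exists_rescaling_limit {F : ℕ → ℂ → RiemannSphere} (hF : ∀ k z, IsHoloAt (F k) z)
    {a : ℕ → ℂ} {a₀ : ℂ} (ha : Tendsto a atTop (𝓝 a₀))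
    (hd : ∀ k : ℕ, ((k : ℝ) + 1) ^ 2 ≤ ‖fderiv ℝ (fun z => embed (F k z)) (a k)‖) :
    ∃ l : Filter ℕ, l.NeBot ∧ l ≤ atTop ∧ ∃ (x : ℕ → ℂ) (ρ : ℕ → ℝ) (g : ℂ → RiemannSphere),
      Tendsto x l (𝓝 a₀) ∧ Tendsto ρ l (𝓝 0) ∧ (∀ k, ρ k ≠ 0) ∧ (∀ z, IsHoloAt g z) ∧
      TendstoContinuously l (fun k w => F k (x k + ρ k * w)) g ∧ ∀ p, ¬ ∀ w, g w = p := by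
  set φ : ℕ → ℂ → ℝ := fun k z => ‖fderiv ℝ (fun z => embed (F k z)) z‖ with hφ
  have hcont : ∀ k, Continuous (φ k) := fun k =>
    ((contDiff_iff_contDiffAt.2 fun z => (hF k z).contDiffAt).continuous_fderiv one_ne_zero).norm
  have hε : ∀ k : ℕ, (0 : ℝ) < 1 / (k + 1) := fun k => by positivity
  -- Hofer's lemma moves `a k` by at most `2 / (k + 1)` to a point `x k` such that `φ k ≤ 2 * φ k (x
  -- k)` within distance `ε' k`, without decreasing the product of radius and derivative. The square
  -- in `hd` makes this product at least `k + 1`.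
  choose ε' hε'0 x hε' hxa hprod hmax using fun k : ℕ =>
    hofer (a k) (1 / ((k : ℝ) + 1)) (hε k) (hcont k) fun z => norm_nonneg _
  have hbig : ∀ k : ℕ, (k : ℝ) + 1 ≤ ε' k * φ k (x k) := by
    intro k
    refine le_trans ?_ (hprod k)
    have := mul_le_mul_of_nonneg_left (hd k) (hε k).le
    refine le_trans (le_of_eq ?_) this
    field_simp
  have hφpos : ∀ k, 0 < φ k (x k) := by
    intro k
    have h1 : 0 < ε' k * φ k (x k) := lt_of_lt_of_le (by positivity) (hbig k)
    exact (pos_iff_pos_of_mul_pos h1).1 (hε'0 k)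
  -- This scale makes the rescaled derivative equal to `1` at `0`. As `ρ k * (k + 1) ≤ ε' k`, it is
  -- at most `2` on the ball of radius `k`.
  set ρ : ℕ → ℝ := fun k => (φ k (x k))⁻¹ with hρ
  have hρpos : ∀ k, 0 < ρ k := fun k => inv_pos.2 (hφpos k)
  have hρε : ∀ k : ℕ, ρ k * (k + 1) ≤ ε' k := by
    intro k
    rw [hρ, inv_mul_le_iff₀ (hφpos k), mul_comm]
    exact hbig k
  have hρle : ∀ k : ℕ, ρ k ≤ 1 / ((k : ℝ) + 1) := by
    intro k
    have h1 : ρ k * 1 ≤ ρ k * (k + 1) :=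
      mul_le_mul_of_nonneg_left (by simp) (hρpos k).le
    have := hρε k
    have := hε' k
    linarith
  have hG : ∀ k z, IsHoloAt (fun w => F k (x k + ρ k * w)) z := fun k z =>
    IsHoloAt.comp (e := fun w => x k + ρ k * w) (hF k _) (by fun_prop)
  have hnorm : ∀ (k : ℕ) (w : ℂ), ‖fderiv ℝ (fun y => embed (F k (x k + ρ k * y))) w‖ =
      ρ k * φ k (x k + ρ k * w) := fun k w =>
    norm_fderiv_embed_comp_affine (hF k) (x k) (hρpos k).le w
  have hbd : ∀ k : ℕ, ∀ w ∈ ball (0 : ℂ) k,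
      ‖fderiv ℝ (fun y => embed (F k (x k + ρ k * y))) w‖ ≤ 2 := by
    intro k w hw
    rw [hnorm, hρ, inv_mul_le_iff₀ (hφpos k), mul_comm _ 2]
    refine hmax k _ ?_
    rw [dist_self_add_right, norm_mul, Complex.norm_real, Real.norm_of_nonneg (hρpos k).le]
    refine le_trans (mul_le_mul_of_nonneg_left ?_ (hρpos k).le) (hρε k)
    rw [mem_ball_zero_iff] at hw
    linarith
  have hl : ((hyperfilter ℕ : Ultrafilter ℕ) : Filter ℕ) ≤ atTop := Nat.hyperfilter_le_atTop
  obtain ⟨g, hg⟩ := exists_tendstoContinuously hl two_pos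
    (G := fun k w => F k (x k + ρ k * w)) fun k z hz w hw =>
      dist_embed_le (hG k) (convex_ball 0 k) (hbd k) hz hw
  have h0 := tendsto_one_div_add_atTop_nhds_zero_nat (𝕜 := ℝ)
  refine ⟨hyperfilter ℕ, inferInstance, hl, x, ρ, g, ?_, ?_, fun k => (hρpos k).ne',
    IsHoloAt.of_tendstoContinuously hG hg, hg,
    not_const_of_norm_fderiv_embed_eq_one hG hg 0 fun k => ?_⟩
  · refine Tendsto.mono_left ?_ hl
    refine (tendsto_iff_of_dist ?_).1 ha
    refine squeeze_zero (fun k => dist_nonneg) (fun k => ?_)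
      (by simpa only [mul_zero] using h0.const_mul 2)
    rw [dist_comm]
    exact hxa k
  · exact (squeeze_zero (fun k => (hρpos k).le) hρle h0).mono_left hl
  · rw [hnorm, mul_zero, add_zero]
    exact inv_mul_cancel₀ (hφpos k).ne'

end RiemannSphere

/-! ### Picard's theorem -/

namespace RiemannSphere

open Filter Topology Set Metric

theorem exists_differentiable_exp_eq {u : ℂ → ℂ} (hu : Differentiable ℂ u) (h0 : ∀ z, u z ≠ 0) :
    ∃ L : ℂ → ℂ, Differentiable ℂ L ∧ ∀ z, Complex.exp (L z) = u z := by
  have h1 : Differentiable ℂ fun z => deriv u z / u z :=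
    hu.contDiff.differentiable_deriv_two.div hu h0
  obtain ⟨L, hL0, hL⟩ := h1.isExactOn_univ.with_val_at 0 (Complex.log (u 0))
  have hLd : ∀ z, HasDerivAt L (deriv u z / u z) z := fun z => hL z (mem_univ z)
  refine ⟨L, fun z => (hLd z).differentiableAt, fun z => ?_⟩
  have h2 : ∀ z, HasDerivAt (fun z => u z * Complex.exp (-L z)) 0 z := by
    intro z
    have h3 := (hu z).hasDerivAt.mul (hLd z).neg.cexp
    refine h3.congr_deriv ?_
    have := h0 z
    field_simp
    ring
  have h4 := is_const_of_deriv_eq_zero (fun z => (h2 z).differentiableAt)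
    (fun z => (h2 z).deriv) z 0
  simp only [hL0, Complex.exp_neg, Complex.exp_log (h0 0)] at h4
  rw [mul_inv_cancel₀ (h0 0)] at h4
  exact (eq_of_mul_inv_eq_one h4).symm

theorem exists_differentiable_pow_eq {u : ℂ → ℂ} (hu : Differentiable ℂ u) (h0 : ∀ z, u z ≠ 0)
    {n : ℕ} (hn : n ≠ 0) : ∃ v : ℂ → ℂ, Differentiable ℂ v ∧ ∀ z, v z ^ n = u z := by
  obtain ⟨L, hL, hLu⟩ := exists_differentiable_exp_eq hu h0
  refine ⟨fun z => Complex.exp (L z / n), (hL.div_const _).cexp, fun z => ?_⟩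
  have : (n : ℂ) ≠ 0 := by exact_mod_cast hn
  rw [← Complex.exp_nat_mul, mul_div_cancel₀ _ this, hLu]

/-- Stereographic projection `(ξ, t) ↦ ξ / (1 - t)` is a differentiable left inverse that recovers
`v`, so a vanishing derivative after `embed` would force `deriv v z = 0`. -/
theorem fderiv_embed_coe_ne_zero {v : ℂ → ℂ} {z : ℂ} (hv : AnalyticAt ℂ v z)
    (hd : deriv v z ≠ 0) : fderiv ℝ (fun w => embed (OnePoint.some (v w))) z ≠ 0 := by
  intro h0
  have h1 := ((IsHoloAt.coe hv).contDiffAt.differentiableAt one_ne_zero).hasFDerivAt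
  rw [h0] at h1
  have hne : ∀ y : ℂ, (1 : ℝ) - (‖y‖ ^ 2 - 1) / (1 + ‖y‖ ^ 2) = 2 / (1 + ‖y‖ ^ 2) := fun y => by
    have : (1 + ‖y‖ ^ 2 : ℝ) ≠ 0 := by positivity
    field_simp
    ring
  have hτ : DifferentiableAt ℝ (fun p : ℂ × ℝ => (1 - p.2)⁻¹ • p.1)
      (embed (OnePoint.some (v z))) := by
    refine (((differentiableAt_const (1 : ℝ)).sub differentiableAt_snd).inv ?_).smul
      differentiableAt_fst
    rw [Pi.sub_apply]
    rw [embed_coe, hne]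
    positivity
  have h2 := hτ.hasFDerivAt.comp z h1
  have h3 : ((fun p : ℂ × ℝ => (1 - p.2)⁻¹ • p.1) ∘ fun w => embed (OnePoint.some (v w))) = v := by
    funext w
    have h4 : ((1 + ‖v w‖ ^ 2 : ℝ) : ℂ) ≠ 0 := by
      have : (1 + ‖v w‖ ^ 2 : ℝ) ≠ 0 := by positivity
      exact_mod_cast this
    simp only [Function.comp_apply, embed_coe]
    rw [hne, Complex.real_smul, inv_div, Complex.ofReal_div, Complex.ofReal_ofNat]
    field_simp
  rw [h3, ContinuousLinearMap.comp_zero] at h2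
  have h5 := h2.unique (hv.differentiableAt.hasFDerivAt.restrictScalars ℝ)
  have h6 := congrArg (fun f => f 1) h5
  simp at h6
  exact hd h6.symm

/-- The roots of unity of order a power of two are dense in the unit circle. -/
theorem exists_pow_two_pow_eq_one_mem {c : ℂ} (hc : ‖c‖ = 1) {s : Set ℂ} (hs : s ∈ 𝓝 c) :
    ∃ m : ℕ, ∃ ζ ∈ s, ζ ^ 2 ^ m = 1 := by
  -- The shift by a full turn makes `t` nonnegative, so that natural-number floors give the dyadic
  -- approximations.
  set t : ℝ := Complex.arg c / (2 * Real.pi) + 1 with ht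
  have hπ := Real.pi_pos
  have ht0 : 0 ≤ t := by
    have h1 := Complex.neg_pi_lt_arg c
    have h2 : -1 ≤ Complex.arg c / (2 * Real.pi) := by
      rw [le_div_iff₀ (by positivity)]; linarith
    linarith
  have hct : Complex.exp (2 * Real.pi * Complex.I * t) = c := by
    have h3 : (2 * Real.pi * Complex.I * t : ℂ) =
        Complex.arg c * Complex.I + 2 * Real.pi * Complex.I := by
      have : (Real.pi : ℂ) ≠ 0 := by exact_mod_cast hπ.ne'
      rw [ht]
      push_cast
      field_simp
    rw [h3, Complex.exp_periodic]
    have := Complex.norm_mul_exp_arg_mul_I c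
    rwa [hc, Complex.ofReal_one, one_mul] at this
  have h4 : Tendsto (fun m : ℕ => (⌊t * 2 ^ m⌋₊ : ℝ) / 2 ^ m) atTop (𝓝 t) :=
    (tendsto_nat_floor_mul_div_atTop ht0).comp (tendsto_pow_atTop_atTop_of_one_lt one_lt_two)
  have hcont : Continuous fun x : ℝ => Complex.exp (2 * Real.pi * Complex.I * x) := by fun_prop
  have h5 := (hcont.tendsto t).comp h4
  rw [hct] at h5
  obtain ⟨m, hm⟩ := (h5.eventually hs).exists
  refine ⟨m, _, hm, ?_⟩
  rw [Function.comp_apply, ← Complex.exp_nat_mul]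
  push_cast
  rw [show (2 : ℂ) ^ m * (2 * Real.pi * Complex.I * (⌊t * 2 ^ m⌋₊ / 2 ^ m)) =
    (⌊t * 2 ^ m⌋₊ : ℂ) * (2 * Real.pi * Complex.I) by field_simp]
  exact Complex.exp_nat_mul_two_pi_mul_I _

/-- By the intermediate value theorem `‖v‖` stays on one side of `1`; Liouville then applies to `v`
or to `1 / v`. -/
theorem eq_const_of_norm_ne_one {v : ℂ → ℂ} (hv : Differentiable ℂ v)
    (h1 : ∀ z, ‖v z‖ ≠ 1) : ∀ z w, v z = v w := by
  intro z w
  by_cases h : ∃ y, ‖v y‖ ≤ 1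
  · obtain ⟨y, hy⟩ := h
    refine hv.apply_eq_apply_of_bounded ?_ z w
    refine (isBounded_closedBall (x := (0 : ℂ)) (r := 1)).subset ?_
    rintro _ ⟨x, rfl⟩
    rw [mem_closedBall_zero_iff]
    by_contra! hx
    obtain ⟨c, hc⟩ := mem_range_of_exists_le_of_exists_ge hv.continuous.norm ⟨y, hy⟩ ⟨x, hx.le⟩
    exact h1 c hc
  · push Not at h
    have h0 : ∀ y, v y ≠ 0 := fun y => norm_pos_iff.1 (one_pos.trans (h y))
    have h2 : Differentiable ℂ fun y => (v y)⁻¹ := hv.inv h0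
    refine inv_injective (h2.apply_eq_apply_of_bounded ?_ z w)
    refine (isBounded_closedBall (x := (0 : ℂ)) (r := 1)).subset ?_
    rintro _ ⟨x, rfl⟩
    rw [mem_closedBall_zero_iff, norm_inv]
    exact inv_le_one_of_one_le₀ (h x).le

/-- **Picard's little theorem**: an entire function omitting `0` and `1` is constant. -/
theorem eq_const_of_ne_zero_of_ne_one {u : ℂ → ℂ} (hu : Differentiable ℂ u) (h0 : ∀ z, u z ≠ 0)
    (h1 : ∀ z, u z ≠ 1) : ∀ z w, u z = u w := by
  by_contra hnc
  obtain ⟨c, hc⟩ : ∃ c, deriv u c ≠ 0 := by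
    by_contra! hd
    exact hnc (is_const_of_deriv_eq_zero hu hd)
  choose v hv hvu using fun k : ℕ => exists_differentiable_pow_eq hu h0
    (n := 2 ^ k) (by positivity)
  have hva : ∀ k z, AnalyticAt ℂ (v k) z := fun k z => (hv k).analyticAt z
  have hvd : ∀ k, deriv (v k) c ≠ 0 := by
    intro k hk
    have h2 : u = fun z => v k z ^ 2 ^ k := funext fun z => (hvu k z).symm
    apply hc
    rw [h2, ((hv k c).hasDerivAt.fun_pow (2 ^ k)).deriv, hk, mul_zero]
  set D : ℕ → ℝ := fun k => ‖fderiv ℝ (fun w => embed (OnePoint.some (v k w))) c‖ with hD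
  have hDpos : ∀ k, 0 < D k := fun k =>
    norm_pos_iff.2 (fderiv_embed_coe_ne_zero (hva k c) (hvd k))
  have hlampos : ∀ k : ℕ, 0 ≤ ((k : ℝ) + 1) ^ 2 / D k := fun k => by
    have := hDpos k
    positivity
  have hF' : ∀ k z, IsHoloAt (fun w => OnePoint.some (v k w)) z := fun k z => IsHoloAt.coe (hva k z)
  -- Dilating about `c` gives `v k` the spherical derivative `(k + 1) ^ 2` at `0`. Dilation of the
  -- plane leaves the omitted values omitted, so blow-up can be imposed by hand.
  have hF : ∀ k z, IsHoloAt
      (fun z => OnePoint.some (v k (c + (((k + 1) ^ 2 / D k : ℝ) : ℂ) * z))) z := fun k z =>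
    IsHoloAt.comp (e := fun z => c + (((k + 1) ^ 2 / D k : ℝ) : ℂ) * z) (hF' k _) (by fun_prop)
  obtain ⟨l, hl, hlt, x, ρ, g, -, -, -, hg, hlim, hgc⟩ :=
    exists_rescaling_limit hF (a := fun _ => 0) (a₀ := 0) tendsto_const_nhds (fun k => by
      rw [norm_fderiv_embed_comp_affine (hF' k) c (hlampos k), mul_zero, add_zero,
        div_mul_cancel₀ _ (hDpos k).ne'])
  have hG : ∀ k z, IsHoloAt (fun w => OnePoint.some
      (v k (c + (((k + 1) ^ 2 / D k : ℝ) : ℂ) * (x k + ρ k * w)))) z := fun k z =>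
    IsHoloAt.comp (e := fun w => x k + ρ k * w) (hF k _) (by fun_prop)
  -- By Hurwitz the non-constant limit inherits every value omitted by all late `v k`.
  have homit : ∀ p : RiemannSphere, (∃ m, ∀ k ≥ m, ∀ z, OnePoint.some (v k z) ≠ p) →
      ∀ w, g w ≠ p := by
    rintro p ⟨m, hm⟩ w hw
    have h2 := eventually_exists_eq_of_tendstoContinuously hG
      (H := fun _ _ => p) (h := fun _ => p)
      (fun k z => by
        obtain ⟨a, b, hab, rfl⟩ := exists_eq_frac p
        exact ⟨fun _ => a, fun _ => b, analyticAt_const, analyticAt_const, hab,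
          Eventually.of_forall fun _ => rfl⟩) hlim
      (fun _ => tendsto_const_nhds) hw
      (fun hev => hgc p (eq_of_eventually_eq_of_isHoloAt hg hev)) one_pos
    obtain ⟨k, ⟨y, -, hy⟩, hk⟩ := (h2.and (hlt (eventually_ge_atTop m))).exists
    exact hm k hk _ hy
  have hinf : ∀ w, g w ≠ OnePoint.infty := homit _ ⟨0, fun k _ z => OnePoint.coe_ne_infty _⟩
  have hV : Differentiable ℂ fun w => toComplex (g w) := fun w =>
    ((hg w).analyticAt_toComplex (hinf w)).differentiableAt
  have hroot : ∀ m : ℕ, ∀ ζ : ℂ, ζ ^ 2 ^ m = 1 → ∀ w, toComplex (g w) ≠ ζ := by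
    intro m ζ hζ w hw
    refine homit (OnePoint.some ζ) ⟨m, fun k hk z hz => h1 z ?_⟩ w
      (by rw [← hw, coe_toComplex (hinf w)])
    obtain ⟨j, rfl⟩ := Nat.exists_eq_add_of_le hk
    rw [OnePoint.coe_eq_coe] at hz
    rw [← hvu (m + j), hz, pow_add, pow_mul, hζ, one_pow]
  have hVc : ¬ ∀ z w, toComplex (g z) = toComplex (g w) := fun h2 =>
    hgc (g 0) fun w => by rw [← coe_toComplex (hinf w), h2 w 0, coe_toComplex (hinf 0)]
  refine hVc (eq_const_of_norm_ne_one hV fun w hw => ?_)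
  -- If the limit met the unit circle, its image would, by openness, contain a neighbourhood of that
  -- point and hence an omitted root of unity.
  rcases (hV.analyticAt w).eventually_constant_or_nhds_le_map_nhds with h2 | h2
  · refine hgc (g w) (eq_of_eventually_eq_of_isHoloAt hg (x := w) (h2.mono fun y hy => ?_))
    rw [← coe_toComplex (hinf y), hy, coe_toComplex (hinf w)]
  · obtain ⟨m, ζ, ⟨y, hy⟩, hζ⟩ := exists_pow_two_pow_eq_one_mem hw (h2 (range_mem_map))
    exact hroot m ζ hζ y hy

theorem frac_eq_frac {a b c d : ℂ} (h : a ≠ 0 ∨ b ≠ 0) (h' : c ≠ 0 ∨ d ≠ 0)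
    (he : a * d = c * b) : frac a b = frac c d := by
  by_cases hb : b = 0
  · subst hb
    have ha : a ≠ 0 := by simpa using h
    have hd : d = 0 := by simpa [ha] using he
    rw [hd, frac_zero, frac_zero]
  · have hd : d ≠ 0 := by
      rintro rfl
      have hc : c ≠ 0 := by simpa using h'
      simp [hb, hc] at he
    rw [frac_of_ne hb, frac_of_ne hd, (div_eq_div_iff hb hd).2 he]

theorem cross_mul_ne_zero {p q c : ℂ} (h : p ≠ 0 ∨ q ≠ 0) (hc : frac p q ≠ OnePoint.some c) :
    p - c * q ≠ 0 := by
  intro h0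
  refine hc ?_
  rw [← frac_one c]
  exact frac_eq_frac h (Or.inr one_ne_zero) (by linear_combination h0)

/-- The Möbius transformation sending `a`, `b`, `c` to `0`, `1`, `∞`, with junk value at `c`. -/
noncomputable def crossRatio (a b c : ℂ) : RiemannSphere → ℂ
  | OnePoint.some w => (w - a) * (b - c) / ((w - c) * (b - a))
  | OnePoint.infty => (b - c) / (b - a)

theorem crossRatio_frac {a b c p q : ℂ} (h : p ≠ 0 ∨ q ≠ 0) :
    crossRatio a b c (frac p q) = (p - a * q) * (b - c) / ((p - c * q) * (b - a)) := by
  by_cases hq : q = 0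
  · subst hq
    have hp : p ≠ 0 := by simpa using h
    rw [frac_zero, mul_zero, mul_zero, sub_zero, mul_div_mul_left _ _ hp]
    rfl
  · rw [frac_of_ne hq]
    have h1 : ∀ d, p - d * q = q * (p / q - d) := fun d => by field_simp
    rw [h1, h1, mul_assoc, mul_assoc, mul_div_mul_left _ _ hq]
    rfl

/-- **Picard's theorem** for holomorphic maps from the plane to the sphere. -/
theorem eq_const_of_omits_three {g : ℂ → RiemannSphere} (hg : ∀ z, IsHoloAt g z) {a b c : ℂ}
    (hab : a ≠ b) (hbc : b ≠ c) (hac : a ≠ c) (ha : ∀ z, g z ≠ OnePoint.some a)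
    (hb : ∀ z, g z ≠ OnePoint.some b) (hc : ∀ z, g z ≠ OnePoint.some c) (z w : ℂ) :
    g z = g w := by
  have hba : b - a ≠ 0 := sub_ne_zero.2 hab.symm
  have hbc' : b - c ≠ 0 := sub_ne_zero.2 hbc
  have hac' : a - c ≠ 0 := sub_ne_zero.2 hac
  have hcoord : ∀ z, ∃ p q : ℂ, (p ≠ 0 ∨ q ≠ 0) ∧ g z = frac p q ∧ p - a * q ≠ 0 ∧
      p - b * q ≠ 0 ∧ p - c * q ≠ 0 := by
    intro z
    obtain ⟨p, q, h, he⟩ := exists_eq_frac (g z)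
    exact ⟨p, q, h, he, cross_mul_ne_zero h (he ▸ ha z), cross_mul_ne_zero h (he ▸ hb z),
      cross_mul_ne_zero h (he ▸ hc z)⟩
  have hd : Differentiable ℂ fun z => crossRatio a b c (g z) := by
    intro z
    obtain ⟨u, v, hu, hv, h, he⟩ := hg z
    have h1 : u z - c * v z ≠ 0 := cross_mul_ne_zero h (he.self_of_nhds ▸ hc z)
    have hud := hu.differentiableAt
    have hvd := hv.differentiableAt
    have h2 : DifferentiableAt ℂ
        (fun w => (u w - a * v w) * (b - c) / ((u w - c * v w) * (b - a))) z :=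
      DifferentiableAt.div (by fun_prop) (by fun_prop) (mul_ne_zero h1 hba)
    refine h2.congr_of_eventuallyEq ?_
    filter_upwards [he, IsHoloAt.eventually_ne hu hv h] with w hw hw'
    rw [hw, crossRatio_frac hw']
  have key := eq_const_of_ne_zero_of_ne_one hd (fun z => by
    obtain ⟨p, q, h, he, h1, h2, h3⟩ := hcoord z
    rw [he, crossRatio_frac h]
    exact div_ne_zero (mul_ne_zero h1 hbc') (mul_ne_zero h3 hba)) (fun z h1z => by
    obtain ⟨p, q, h, he, h1, h2, h3⟩ := hcoord z
    rw [he, crossRatio_frac h, div_eq_one_iff_eq (mul_ne_zero h3 hba)] at h1z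
    refine mul_ne_zero hac' h2 ?_
    linear_combination h1z) z w
  obtain ⟨p, q, h, he, h1, h2, h3⟩ := hcoord z
  obtain ⟨p', q', h', he', h1', h2', h3'⟩ := hcoord w
  rw [he, he', crossRatio_frac h, crossRatio_frac h',
    div_eq_div_iff (mul_ne_zero h3 hba) (mul_ne_zero h3' hba)] at key
  rw [he, he']
  refine frac_eq_frac h h' ?_
  refine mul_left_cancel₀ (mul_ne_zero (mul_ne_zero hbc' hba) hac') ?_
  linear_combination key

end RiemannSphere

/-! ### Normality, charts and the Julia set -/

namespace RiemannSphere

open Filter Topology Set Metric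

/-- An involution of the Riemann sphere that preserves holomorphy, used to give charts
`z ↦ c z` covering the sphere. -/
structure IsHoloInvolution (c : RiemannSphere → RiemannSphere) : Prop where
  holo : ∀ (F : ℂ → RiemannSphere) (z : ℂ), IsHoloAt F z → IsHoloAt (fun w => c (F w)) z
  continuous : Continuous c
  involutive : Function.Involutive c

theorem isHoloInvolution_id : IsHoloInvolution id :=
  ⟨fun _ _ h => h, continuous_id, fun _ => rfl⟩

theorem isHoloInvolution_swap : IsHoloInvolution swap :=
  ⟨fun _ _ h => h.swap, continuous_swap, swap_swap⟩

theorem exists_chart (p : RiemannSphere) :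
    ∃ c, IsHoloInvolution c ∧ ∃ a : ℂ, c (OnePoint.some a) = p := by
  induction p using OnePoint.rec with
  | infty => exact ⟨swap, isHoloInvolution_swap, 0, swap_zero⟩
  | coe z => exact ⟨id, isHoloInvolution_id, z, rfl⟩

theorem IsHoloInvolution.isOpen_image {c : RiemannSphere → RiemannSphere}
    (hc : IsHoloInvolution c) {s : Set ℂ} (hs : IsOpen s) :
    IsOpen ((fun z : ℂ => c (OnePoint.some z)) '' s) := by
  rw [show (fun z : ℂ => c (OnePoint.some z)) = c ∘ OnePoint.some from rfl, image_comp,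
    image_eq_preimage_of_inverse hc.involutive hc.involutive]
  exact (OnePoint.isOpenEmbedding_coe.isOpenMap _ hs).preimage hc.continuous

/-- A family of maps with bounded spherical derivatives in a chart is normal. -/
theorem isNormalOn_of_norm_fderiv_le {ι : Type*} {F : ι → RiemannSphere → RiemannSphere}
    {c : RiemannSphere → RiemannSphere} (hc : IsHoloInvolution c)
    (hF : ∀ n z, IsHoloAt (fun w => F n (c (OnePoint.some w))) z) {a : ℂ} {r M : ℝ}
    (hM : ∀ n, ∀ z ∈ closedBall a r,
      ‖fderiv ℝ (fun w => embed (F n (c (OnePoint.some w)))) z‖ ≤ M) :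
    IsNormalOn F ((fun z : ℂ => c (OnePoint.some z)) '' closedBall a r) := by
  intro s
  have : CompactSpace (closedBall a r) := isCompact_iff_compactSpace.1 (isCompact_closedBall a r)
  have hcont : ∀ n, Continuous fun x : closedBall a r =>
      embed (F n (c (OnePoint.some (x : ℂ)))) := fun n =>
    continuous_embed.comp ((continuous_iff_continuousAt.2 fun z => (hF n z).continuousAt).comp
      continuous_subtype_val)
  -- Arzelà–Ascoli is applied to the embedded maps, which are equi-Lipschitz on the disc with values
  -- in the compact set `range embed`; closedness of that range brings the limit back to the sphere.
  set B : ℕ → BoundedContinuousFunction (closedBall a r) (ℂ × ℝ) := fun n =>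
    BoundedContinuousFunction.mkOfCompact ⟨_, hcont (s n)⟩ with hB
  have hBapp : ∀ n (x : closedBall a r), B n x = embed (F (s n) (c (OnePoint.some (x : ℂ)))) :=
    fun n x => rfl
  have hrange : IsCompact (range embed) := isCompact_range continuous_embed
  have hcompact : IsCompact (closure (range B)) := by
    refine BoundedContinuousFunction.arzela_ascoli _ hrange _ ?_ ?_
    · rintro _ x ⟨n, rfl⟩
      exact mem_range_self _
    · refine equicontinuous_of_continuity_modulus (fun d => M * d) ?_ _ ?_
      · have : Continuous fun d : ℝ => M * d := by fun_prop
        simpa using this.tendsto 0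
      · rintro x y ⟨_, n, rfl⟩
        exact dist_embed_le (hF (s n)) (convex_closedBall a r) (hM (s n)) y.2 x.2
  obtain ⟨h, -, φ, hφ, hlim⟩ := hcompact.tendsto_subseq fun n => subset_closure (mem_range_self n)
  have hh : ∀ x, ∃ p, embed p = h x := fun x => by
    have h1 : Tendsto (fun n => B (φ n) x) atTop (𝓝 (h x)) :=
      ((BoundedContinuousFunction.lipschitz_eval_const x).continuous.tendsto h).comp hlim
    exact hrange.isClosed.mem_of_tendsto h1 (Eventually.of_forall fun n => mem_range_self _)
  choose g hg using hh
  classical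
  refine ⟨φ, hφ, fun p => if hp : toComplex (c p) ∈ closedBall a r then g ⟨_, hp⟩
    else OnePoint.infty, fun K hK _ ε hε => ?_⟩
  obtain ⟨δ, hδ, hδε⟩ := exists_sphericalDist_lt hε
  obtain ⟨N, hN⟩ := Metric.tendsto_atTop.1 hlim δ hδ
  refine ⟨N, fun n hn p hp => ?_⟩
  obtain ⟨z, hz, rfl⟩ := hK hp
  simp only [hc.involutive (OnePoint.some z), toComplex_coe, hz, dif_pos]
  refine hδε _ _ ?_
  rw [hg]
  exact (BoundedContinuousFunction.dist_coe_le_dist (f := B (φ n)) ⟨z, hz⟩).trans_lt (hN n hn)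

theorem IsNormalOn.mono {ι : Type*} {F : ι → RiemannSphere → RiemannSphere}
    {U V : Set RiemannSphere} (h : IsNormalOn F V) (hUV : U ⊆ V) : IsNormalOn F U := by
  intro s
  obtain ⟨φ, hφ, g, hg⟩ := h s
  exact ⟨φ, hφ, g, fun K hK => hg K (hK.trans hUV)⟩

/-- Near a point of the Julia set the spherical derivatives of the iterates are unbounded. -/
theorem exists_fderiv_large_of_mem_juliaSet {f : RiemannSphere → RiemannSphere}
    {c : RiemannSphere → RiemannSphere} (hc : IsHoloInvolution c)
    (hf : ∀ n z, IsHoloAt (fun w => f^[n] (c (OnePoint.some w))) z) {a : ℂ}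
    (ha : c (OnePoint.some a) ∈ juliaSet f) {r : ℝ} (hr : 0 < r) (M : ℝ) :
    ∃ n, ∃ z ∈ closedBall a r, M ≤ ‖fderiv ℝ (fun w => embed (f^[n] (c (OnePoint.some w)))) z‖ := by
  by_contra! h
  refine ha ⟨_, ⟨hc.isOpen_image (isOpen_ball (x := a) (ε := r)), ?_⟩,
    mem_image_of_mem _ (mem_ball_self hr)⟩
  exact (isNormalOn_of_norm_fderiv_le (F := fun n : ℕ => f^[n]) hc hf
    fun n z hz => (h n z hz).le).mono (image_mono ball_subset_closedBall)

/-- A sequence of iterates near a point of the Julia set whose spherical derivatives blow up. -/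
theorem exists_seq_of_mem_juliaSet {f : RiemannSphere → RiemannSphere}
    {c : RiemannSphere → RiemannSphere} (hc : IsHoloInvolution c)
    (hf : ∀ n z, IsHoloAt (fun w => f^[n] (c (OnePoint.some w))) z) {a : ℂ}
    (ha : c (OnePoint.some a) ∈ juliaSet f) :
    ∃ (n : ℕ → ℕ) (x : ℕ → ℂ), Tendsto x atTop (𝓝 a) ∧ ∀ k : ℕ, ((k : ℝ) + 1) ^ 2 ≤
      ‖fderiv ℝ (fun w => embed (f^[n k] (c (OnePoint.some w)))) (x k)‖ := by
  choose n x hx hn using fun k : ℕ => exists_fderiv_large_of_mem_juliaSet hc hf ha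
    (r := 1 / ((k : ℝ) + 1)) (by positivity) (((k : ℝ) + 1) ^ 2)
  refine ⟨n, x, ?_, hn⟩
  rw [tendsto_iff_dist_tendsto_zero]
  exact squeeze_zero (fun _ => dist_nonneg) hx tendsto_one_div_add_atTop_nhds_zero_nat

theorem not_mem_juliaSet_of_const {f : RiemannSphere → RiemannSphere} {p : RiemannSphere}
    (hf : ∀ z, f z = p) (z : RiemannSphere) : z ∉ juliaSet f := by
  intro hz
  obtain ⟨c, hc, a, rfl⟩ := exists_chart z
  have h0 : ∀ w, IsHoloAt (fun w => c (OnePoint.some w)) w := fun w =>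
    hc.holo _ _ (IsHoloAt.coe analyticAt_id)
  have hsucc : ∀ n z, f^[n + 1] z = p := fun n z => by rw [Function.iterate_succ_apply', hf]
  have hholo : ∀ n w, IsHoloAt (fun w => f^[n] (c (OnePoint.some w))) w := by
    rintro (_ | n) w
    · exact h0 w
    · simp only [hsucc]
      obtain ⟨u, v, huv, rfl⟩ := exists_eq_frac p
      exact ⟨_, _, analyticAt_const, analyticAt_const, huv, Eventually.of_forall fun _ => rfl⟩
  obtain ⟨n, x, hx, hn⟩ := exists_seq_of_mem_juliaSet hc hholo hz
  -- Positive iterates are constant and have zero derivative, so the blow-up could only come from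
  -- the zeroth iterate, whose derivative is continuous at `a`.
  have hn0 : ∀ k, n k = 0 := by
    intro k
    by_contra hk
    obtain ⟨m, hm⟩ := Nat.exists_eq_succ_of_ne_zero hk
    have h1 := hn k
    simp only [hm, Nat.succ_eq_add_one, hsucc, fderiv_const_apply, norm_zero] at h1
    exact absurd h1 (not_le.2 (by positivity))
  simp only [hn0] at hn
  have hcont : Continuous fun z =>
      ‖fderiv ℝ (fun w => embed (f^[0] (c (OnePoint.some w)))) z‖ :=
    ((contDiff_iff_contDiffAt.2 fun z => (hholo 0 z).contDiffAt).continuous_fderiv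
      one_ne_zero).norm
  refine not_tendsto_atTop_of_tendsto_nhds ((hcont.tendsto a).comp hx) ?_
  refine tendsto_atTop_mono (fun k : ℕ => ?_) tendsto_natCast_atTop_atTop
  refine le_trans ?_ (hn k)
  nlinarith [(Nat.cast_nonneg k : (0 : ℝ) ≤ k)]

/-! ### Backward orbits and the density of periodic points -/

/-- Iterate a section `s` of `f`. A repetition in the orbit is a periodic point that some iterate of
`f` carries to `z`, which makes `z` periodic. -/
theorem exists_backward_orbit {X : Type*} {f : X → X} (hf : Function.Surjective f) {z : X}
    (hz : z ∉ Function.periodicPts f) :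
    ∃ y : ℕ → X, Function.Injective y ∧ ∀ n, f^[n] (y n) = z := by
  choose s hs using hf
  have hstep : ∀ n m, f^[n] (s^[n + m] z) = s^[m] z := by
    intro n m
    rw [Function.iterate_add_apply]
    exact (Function.RightInverse.iterate (f := f) (g := s) hs n) _
  have h0 : ∀ n, f^[n] (s^[n] z) = z := fun n => hstep n 0
  refine ⟨fun n => s^[n] z, ?_, h0⟩
  refine Function.Injective.of_lt_imp_ne fun i j hij he => hz ?_
  obtain ⟨d, rfl⟩ := Nat.exists_eq_add_of_lt hij
  refine Function.mk_mem_periodicPts (n := d + 1) d.succ_pos ?_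
  have h1 := hstep (d + 1) i
  rw [show d + 1 + i = i + d + 1 by ring, he] at h1
  have h2 := congrArg f^[i + d + 1] h1
  rw [← Function.iterate_add_apply, add_comm, Function.iterate_add_apply, h0] at h2
  exact h2

theorem exists_iterate_apply_eq_of_omits {R : RatFunc ℂ} (hR : ratDegree R ≠ 0)
    {g : ℂ → RiemannSphere} (hg : ∀ z, IsHoloAt g z) {p : RiemannSphere}
    (hp : ∀ m > 0, ∀ w, (rationalMap R)^[m] (g w) ≠ p)
    (hper : p ∉ Function.periodicPts (rationalMap R)) : ∃ q, ∀ w, g w = q := by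
  obtain ⟨y, hinj, hy⟩ := exists_backward_orbit (rationalMap_surjective R hR) hper
  have homit : ∀ m > 0, ∀ w, g w ≠ y m := fun m hm w hw => hp m hm w (by rw [hw, hy])
  -- Injectivity allows at most one `y m` to be `∞`; beyond it three consecutive terms are distinct
  -- finite omitted values. `M > 0` is needed because `y 0 = z` itself need not be omitted.
  obtain ⟨M, hM0, hM⟩ : ∃ M > 0, ∀ m ≥ M, y m ≠ OnePoint.infty := by
    by_cases h : ∃ i, y i = OnePoint.infty
    · obtain ⟨i, hi⟩ := h
      refine ⟨i + 1, i.succ_pos, fun m hm h' => ?_⟩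
      have := hinj (hi.trans h'.symm)
      omega
    · push Not at h
      exact ⟨1, one_pos, fun m _ => h m⟩
  have hne : ∀ i ≥ M, ∀ j ≥ M, i ≠ j → toComplex (y i) ≠ toComplex (y j) := by
    intro i hi j hj hij h
    refine hij (hinj ?_)
    rw [← coe_toComplex (hM i hi), h, coe_toComplex (hM j hj)]
  have homit' : ∀ i ≥ M, ∀ w, g w ≠ OnePoint.some (toComplex (y i)) := fun i hi w => by
    rw [coe_toComplex (hM i hi)]
    exact homit i (by omega) w
  refine ⟨g 0, fun w => eq_const_of_omits_three hg
    (hne M le_rfl (M + 1) (by omega) (by omega))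
    (hne (M + 1) (by omega) (M + 2) (by omega) (by omega))
    (hne M le_rfl (M + 2) (by omega) (by omega)) (homit' _ le_rfl) (homit' _ (by omega))
    (homit' _ (by omega)) w 0⟩

/-- Supplies the isolation hypothesis of Hurwitz: if `f^[m] ∘ g` were locally equal to `p`, then `g`
would locally take values in the finite fibre of `f^[m]` over `p`. -/
theorem not_eventually_mem_of_finite {g : ℂ → RiemannSphere} (hg : ∀ z, IsHoloAt g z)
    (hgc : ∀ p, ¬ ∀ w, g w = p) {T : Set RiemannSphere} (hT : T.Finite) (x : ℂ) :
    ¬ ∀ᶠ w in 𝓝 x, g w ∈ T := by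
  intro h
  have h1 : ∀ᶠ w in 𝓝[≠] x, ∀ p ∈ T, g w ≠ p := (eventually_all_finite hT).2 fun p _ =>
    ((hg x).eventually_eq_or_eventually_ne p).resolve_left
      fun h2 => hgc p (eq_of_eventually_eq_of_isHoloAt hg h2)
  obtain ⟨w, hw1, hw2⟩ := (h1.and (nhdsWithin_le_nhds h)).exists
  exact hw1 _ hw2 rfl

/-- Every point of the Julia set of a non-constant rational map is a limit of periodic points. -/
theorem mem_closure_periodicPts {R : RatFunc ℂ} (hR : ratDegree R ≠ 0)
    {p : RiemannSphere} (hp : p ∈ juliaSet (rationalMap R)) :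
    p ∈ closure (Function.periodicPts (rationalMap R)) := by
  by_contra hcl
  obtain ⟨c, hc, a, rfl⟩ := exists_chart p
  set f := rationalMap R with hf
  have hchart : ∀ z, IsHoloAt (fun w => c (OnePoint.some w)) z := fun z =>
    hc.holo _ _ (IsHoloAt.coe analyticAt_id)
  have hiter : ∀ n z, IsHoloAt (fun w => f^[n] (c (OnePoint.some w))) z := fun n z =>
    (hchart z).iterate_rationalMap R n
  obtain ⟨n, b, hb, hn⟩ := exists_seq_of_mem_juliaSet hc hiter hp
  obtain ⟨l, hl, -, x, ρ, g, hx, hρ, -, hg, hlim, hgc⟩ :=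
    exists_rescaling_limit (fun k => hiter (n k)) hb hn
  have haff : ∀ k z, AnalyticAt ℂ (fun w : ℂ => x k + ρ k * w) z := fun k z => by fun_prop
  have hH : TendstoContinuously l (fun k w => c (OnePoint.some (x k + ρ k * w)))
      fun _ => c (OnePoint.some a) := by
    intro w
    have h1 : Tendsto (fun q : ℕ × ℂ => x q.1 + ρ q.1 * q.2) (l ×ˢ 𝓝 w) (𝓝 (a + (0 : ℝ) * w)) :=
      (hx.comp tendsto_fst).add
        (((Complex.continuous_ofReal.tendsto 0).comp (hρ.comp tendsto_fst)).mul tendsto_snd)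
    rw [Complex.ofReal_zero, zero_mul, add_zero] at h1
    exact (hchart a).continuousAt.tendsto.comp h1
  have homit : ∀ m > 0, ∀ w, f^[m] (g w) ≠ c (OnePoint.some a) := by
    intro m hm w hw
    -- Fixes a disc about `w` whose rescaled points eventually avoid the closure of the periodic
    -- points; the coincidence found by Hurwitz in this disc is a point of period `m + n k`,
    -- positive since `m > 0` even if `n k = 0`.
    obtain ⟨P, hP, Q, hQ, hPQ⟩ := eventually_prod_iff.1
      ((hH w).eventually (isClosed_closure.isOpen_compl.mem_nhds hcl))
    obtain ⟨r, hr, hball⟩ := Metric.eventually_nhds_iff_ball.1 hQ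
    have h2 := eventually_exists_eq_of_tendstoContinuously (l := l)
      (G := fun k w => f^[m] (f^[n k] (c (OnePoint.some (x k + ρ k * w)))))
      (H := fun k w => c (OnePoint.some (x k + ρ k * w)))
      (fun k z => ((hiter (n k) _).comp (haff k z)).iterate_rationalMap R m)
      (fun k z => (hchart _).comp (haff k z))
      (hlim.comp_left ((continuous_rationalMap R).iterate m)) hH hw
      (not_eventually_mem_of_finite hg hgc (finite_preimage_iterate_rationalMap R hR m _) w) hr
    obtain ⟨k, ⟨y, hy, hyk⟩, hk⟩ := (h2.and hP).exists
    refine hPQ hk (hball y hy) (subset_closure ?_)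
    refine Function.mk_mem_periodicPts (n := m + n k) (by omega) ?_
    rw [Function.IsPeriodicPt, Function.IsFixedPt, Function.iterate_add_apply]
    exact hyk
  obtain ⟨q, hq⟩ := exists_iterate_apply_eq_of_omits hR hg homit
    fun h => hcl (subset_closure h)
  exact hgc q hq

end RiemannSphere

theorem mainTheorem4 (R : RatFunc ℂ) :
    RiemannSphere.juliaSet (RiemannSphere.rationalMap R) ⊆
      closure (Function.periodicPts (RiemannSphere.rationalMap R)) := by
  intro p hp
  -- In degree `0` surjectivity and finiteness of fibres fail, but the map is constant and its Julia
  -- set is empty.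
  by_cases hR : RiemannSphere.ratDegree R = 0
  · obtain ⟨q, hq⟩ := RiemannSphere.exists_rationalMap_eq_const R hR
    exact absurd hp (RiemannSphere.not_mem_juliaSet_of_const hq p)
  · exact RiemannSphere.mem_closure_periodicPts hR hp
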